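/- Let $\Sigma=\mathbb C/\Lambda$ be an elliptic curve with coordinate $z$, let $\sigma=\begin{pmatrix}0&E\\E&0\end{pmatrix}$, and let $\mathfrak g=\mathfrak{so}(2n)$ be realized as the Lie algebra of the complex matrices $$X=\begin{pmatrix}A&B\\C&-A^t\end{pmatrix},\qquad B^t=-B,\quad C^t=-C,$$ with $n\times n$ blocks. Let $D=\sum_i m_iP_i$ be a nonzero effective divisor on $\Sigma$, and let $q_1,\dots,q_n\in\Sigma$ be such that the $2n$ points $\pm q_i$ are pairwise distinct and do not lie in the support of $D$. Fix vectors $\alpha_i=(\alpha_i',\alpha_i'')\in\mathbb C^n\oplus\mathbb C^n$ with $\alpha_i'\neq0$ and $\alpha_{-i}=(\alpha_{-i}',0)\in\mathbb C^n\oplus\mathbb C^n$ with $\alpha_{-i}'\ne0$ $(i=1,\dots,n)$. Let $\mathcal N^D$ be the space of all meromorphic functions $M=\begin{pmatrix}A&B\\C&-A^t\end{pmatrix}:\Sigma\to\mathfrak g$ such that $$(A)+D+\sum_{i=1}^n q_i\ge0,\qquad (C)+D+\sum_{i=1}^n q_i\ge0,\qquad (B)+D+\sum_{i=1}^n(-q_i)\ge0,$$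 where $-q_i$ in the last sum denotes a point of $\Sigma$, and such that there are vectors $\mu_i=(\mu_i',\mu_i'')$ and $\mu_{-i}=(\mu_{-i}',0)$ in $\mathbb C^n\oplus\mathbb C^n$ with $$\operatorname{res}_{q_i}M=(\alpha_i\mu_i^t-\mu_i\alpha_i^t)\sigma,\qquad \operatorname{res}_{-q_i}M=(\alpha_{-i}\mu_{-i}^t-\mu_{-i}\alpha_{-i}^t)\sigma\qquad(i=1,\dots,n).$$ Then $\mathcal N^D$ is finite-dimensional and $$\dim\mathcal N^D=(\dim\mathfrak g)(\deg D+1).$$ Moreover, suppose that $\alpha_{-i}'^{\,t}\alpha_{-i}'\neq0$ for all $i$. Then the same formula holds for the space of those $M\in\mathcal N^D$ for which the vectors $\mu_{\pm i}$ can be chosen so that the motions $\dot q_i=-\mu_i'^{\,t}\alpha_i''-\mu_i''^{\,t}\alpha_i'$ and $(-q_i)^{\cdot}=-\mu_{-i}'^{\,t}\alpha_{-i}'$ of the points $q_i$ and $-q_i$ satisfy $\dot q_i+(-q_i)^{\cdot}=0$ for all $i$. -/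

import Mathlib

open Matrix Topology Filter

noncomputable section

namespace EllipticDn

/-- The elliptic curve `Σ = ℂ / Λ`, where `Λ` is the lattice spanned by a pair of periods. -/
abbrev Curve (L : PeriodPair) : Type := ℂ ⧸ L.lattice

/-- The projection `ℂ → Σ`; the coordinate `z` of `ℂ` is the local coordinate at every point. -/
abbrev proj (L : PeriodPair) (z : ℂ) : Curve L := Submodule.Quotient.mk z

/-- The Riemann-Roch space `H⁰(Σ, O(Δ))` of the meromorphic functions `f` on `Σ` with
`(f) + Δ ≥ 0`, for a divisor `Δ` whose positive part is supported in the set `S` of marked points.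

A meromorphic function is represented by its restriction to `Σ \ S`, where it is holomorphic.
Its values at the points of `S` carry no information and are put equal to `0`, so that different
elements of the space are different meromorphic functions; the orders at the points of `S` are
those of the punctured germs, so that a function of order `≥ 0` at a point of `S` is a function
that is holomorphic there (after the removable singularity is filled in). -/
def rrSpace (L : PeriodPair) (S : Set (Curve L)) (Δ : Curve L →₀ ℤ) :
    Submodule ℂ (Curve L → ℂ) where
  carrier := {f | (∀ p ∈ S, f p = 0) ∧
    (∀ z : ℂ, proj L z ∉ S → AnalyticAt ℂ (fun w => f (proj L w)) z) ∧
    ∀ z : ℂ, MeromorphicAt (fun w => f (proj L w)) z ∧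
      ((-(Δ (proj L z)) : ℤ) : WithTop ℤ) ≤ meromorphicOrderAt (fun w => f (proj L w)) z}
  add_mem' := by
    rintro f g ⟨hf0, hf1, hf2⟩ ⟨hg0, hg1, hg2⟩
    refine ⟨fun p hp => by simp [hf0 p hp, hg0 p hp],
      fun z hz => (hf1 z hz).add (hg1 z hz), fun z => ⟨(hf2 z).1.add (hg2 z).1, ?_⟩⟩
    exact (le_min (hf2 z).2 (hg2 z).2).trans (meromorphicOrderAt_add (hf2 z).1 (hg2 z).1)
  zero_mem' := by
    refine ⟨fun _ _ => rfl, fun z _ => analyticAt_const, fun z => ⟨MeromorphicAt.const 0 z, ?_⟩⟩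
    have h : meromorphicOrderAt (fun w => (0 : Curve L → ℂ) (proj L w)) z = ⊤ :=
      meromorphicOrderAt_eq_top_iff.2 (Eventually.of_forall fun _ => rfl)
    rw [h]
    exact le_top
  smul_mem' := by
    rintro c f ⟨hf0, hf1, hf2⟩
    refine ⟨fun p hp => by simp [hf0 p hp], fun z hz => analyticAt_const.mul (hf1 z hz),
      fun z => ⟨(MeromorphicAt.const c z).mul (hf2 z).1, ?_⟩⟩
    by_cases hc : c = 0
    · have h : meromorphicOrderAt (fun w => (c • f) (proj L w)) z = ⊤ :=
        meromorphicOrderAt_eq_top_iff.2 (Eventually.of_forall fun _ => by simp [hc])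
      rw [h]
      exact le_top
    · have h := meromorphicOrderAt_mul_of_ne_zero (f := fun w => f (proj L w))
        (analyticAt_const (v := c) (x := z)) hc
      exact (hf2 z).2.trans h.ge

/-- The matrices of size `2n`, in blocks of size `n`. -/
abbrev Mat (n : ℕ) : Type := Matrix (Fin n ⊕ Fin n) (Fin n ⊕ Fin n) ℂ

/-- The matrix `σ = (0 E; E 0)`. -/
abbrev sig (n : ℕ) : Mat n := LieAlgebra.Orthogonal.JD (Fin n) ℂ

/-- The Lie algebra `so(2n)` of the matrices `X` with `Xᵗ σ + σ X = 0`, as a vector space. It is the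
underlying space of `LieAlgebra.Orthogonal.typeD (Fin n) ℂ`. -/
abbrev so2n (n : ℕ) : Submodule ℂ (Mat n) := skewAdjointMatricesSubmodule (sig n)

/-- The elements of `so(2n)` are the matrices `(A B; C -Aᵗ)` with skew-symmetric `B`, `C`. -/
theorem mem_so2n_iff {n : ℕ} (X : Mat n) :
    X ∈ so2n n ↔ ∃ A B C : Matrix (Fin n) (Fin n) ℂ,
      Bᵀ = -B ∧ Cᵀ = -C ∧ X = fromBlocks A B C (-Aᵀ) := by
  rw [mem_skewAdjointMatricesSubmodule, Matrix.IsSkewAdjoint, Matrix.IsAdjointPair,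
    sig, LieAlgebra.Orthogonal.JD]
  constructor
  · intro h
    rw [← fromBlocks_toBlocks X] at h
    simp only [fromBlocks_transpose, fromBlocks_multiply, fromBlocks_neg, Matrix.mul_zero,
      Matrix.mul_one, Matrix.zero_mul, Matrix.one_mul, zero_add, add_zero,
      fromBlocks_inj] at h
    obtain ⟨h1, h2, h3, h4⟩ := h
    refine ⟨X.toBlocks₁₁, X.toBlocks₁₂, X.toBlocks₂₁, h4, h1, ?_⟩
    rw [h2, neg_neg, fromBlocks_toBlocks]
  · rintro ⟨A, B, C, hB, hC, rfl⟩
    simp [fromBlocks_transpose, fromBlocks_multiply, fromBlocks_neg, hB, hC]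

/-- The residue at the point `p` of a function on `Σ` with at most a simple pole at `p` is `R`,
with respect to the coordinate `z`. -/
def HasRes {L : PeriodPair} {n : ℕ} (M : Curve L → Mat n) (p : Curve L) (R : Mat n) : Prop :=
  ∀ z : ℂ, proj L z = p → Tendsto (fun w => (w - z) • M (proj L w)) (𝓝[≠] z) (𝓝 R)

/-- The right-hand side `(α μᵗ - μ αᵗ) σ` of the residue condition. -/
def tyurinResidue {n : ℕ} (α μ : Fin n ⊕ Fin n → ℂ) : Mat n :=
  (vecMulVec α μ - vecMulVec μ α) * sig n

/-- The pole divisor and the Tyurin data: an effective divisor `D`, points `q₁, …, qₙ`, the vectors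
`αᵢ = (αᵢ', αᵢ'')` attached to `qᵢ`, and the vectors `α₋ᵢ = (α₋ᵢ', 0)` attached to `-qᵢ`. -/
structure Data (L : PeriodPair) (n : ℕ) where
  /-- the effective divisor `D` -/
  D : Curve L →₀ ℕ
  /-- the points `qᵢ` -/
  q : Fin n → Curve L
  /-- the vectors `αᵢ'` -/
  a' : Fin n → Fin n → ℂ
  /-- the vectors `αᵢ''` -/
  a'' : Fin n → Fin n → ℂ
  /-- the vectors `α₋ᵢ'` -/
  am : Fin n → Fin n → ℂ

namespace Data

variable {L : PeriodPair} {n : ℕ} (T : Data L n)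

/-- The degree of `D`. -/
def deg : ℕ := T.D.sum fun _ m => m

/-- The points `qᵢ`, `-qᵢ` are `2n` distinct points of `Σ`, none of which lies in the support of
`D`; the vectors `αᵢ'`, `α₋ᵢ'` are nonzero. -/
structure Generic : Prop where
  injective : Function.Injective (Sum.elim T.q fun i => -T.q i)
  q_notMem : ∀ i, T.q i ∉ T.D.support
  neg_q_notMem : ∀ i, -T.q i ∉ T.D.support
  a'_ne_zero : ∀ i, T.a' i ≠ 0
  am_ne_zero : ∀ i, T.am i ≠ 0

/-- The marked points: the support of `D` and the points `± qᵢ`. -/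
def marked : Set (Curve L) :=
  ↑T.D.support ∪ Set.range T.q ∪ Set.range fun i => -T.q i

/-- The divisor `D` with integer coefficients. -/
def intD : Curve L →₀ ℤ := T.D.mapRange (fun m : ℕ => (m : ℤ)) Nat.cast_zero

/-- The divisor `D + ∑ qᵢ`. -/
def divPlus : Curve L →₀ ℤ := T.intD + ∑ i, Finsupp.single (T.q i) 1

/-- The divisor `D + ∑ (-qᵢ)`. -/
def divMinus : Curve L →₀ ℤ := T.intD + ∑ i, Finsupp.single (-T.q i) 1

/-- `M` is a meromorphic `so(2n)`-valued function on `Σ` with blocks `(A B; C -Aᵗ)` such that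
`(A) + D + ∑ qᵢ ≥ 0`, `(C) + D + ∑ qᵢ ≥ 0` and `(B) + D + ∑ (-qᵢ) ≥ 0`. -/
structure HasBlocks (M : Curve L → Mat n) : Prop where
  mem_so : ∀ p, M p ∈ so2n n
  blockA : ∀ j k, (fun p => (M p).toBlocks₁₁ j k) ∈ rrSpace L T.marked T.divPlus
  blockB : ∀ j k, (fun p => (M p).toBlocks₁₂ j k) ∈ rrSpace L T.marked T.divMinus
  blockC : ∀ j k, (fun p => (M p).toBlocks₂₁ j k) ∈ rrSpace L T.marked T.divPlus

/-- The residue conditions on `M`, with the parameters `μᵢ = (μᵢ', μᵢ'')` at `qᵢ` and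
`μ₋ᵢ = (μ₋ᵢ', 0)` at `-qᵢ`. -/
structure HasTyurinResidues (M : Curve L → Mat n) (μ' μ'' μm : Fin n → Fin n → ℂ) : Prop where
  res_q : ∀ i, HasRes M (T.q i)
    (tyurinResidue (Sum.elim (T.a' i) (T.a'' i)) (Sum.elim (μ' i) (μ'' i)))
  res_neg_q : ∀ i, HasRes M (-T.q i)
    (tyurinResidue (Sum.elim (T.am i) 0) (Sum.elim (μm i) 0))

/-- The velocity `-μᵢ'ᵗ αᵢ'' - μᵢ''ᵗ αᵢ'` of the pole `qᵢ`. -/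
def velPlus (μ' μ'' : Fin n → Fin n → ℂ) (i : Fin n) : ℂ :=
  -(μ' i ⬝ᵥ T.a'' i) - μ'' i ⬝ᵥ T.a' i

/-- The velocity `-μ₋ᵢ'ᵗ α₋ᵢ'` of the pole `-qᵢ`. -/
def velMinus (μm : Fin n → Fin n → ℂ) (i : Fin n) : ℂ :=
  -(μm i ⬝ᵥ T.am i)

end Data

theorem tyurinResidue_add {n : ℕ} (α μ ν : Fin n ⊕ Fin n → ℂ) :
    tyurinResidue α (μ + ν) = tyurinResidue α μ + tyurinResidue α ν := by
  simp only [tyurinResidue, vecMulVec_add, add_vecMulVec, ← Matrix.add_mul]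
  congr 1
  abel

theorem tyurinResidue_smul {n : ℕ} (c : ℂ) (α μ : Fin n ⊕ Fin n → ℂ) :
    tyurinResidue α (c • μ) = c • tyurinResidue α μ := by
  simp only [tyurinResidue, vecMulVec_smul, smul_vecMulVec, ← smul_sub, Matrix.smul_mul]

theorem tyurinResidue_zero {n : ℕ} (α : Fin n ⊕ Fin n → ℂ) : tyurinResidue α 0 = 0 := by
  simpa using tyurinResidue_smul 0 α 0

theorem HasRes.add {L : PeriodPair} {n : ℕ} {M N : Curve L → Mat n} {p : Curve L} {R R' : Mat n}
    (h : HasRes M p R) (h' : HasRes N p R') : HasRes (M + N) p (R + R') := by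
  intro z hz
  simpa only [Pi.add_apply, smul_add] using (h z hz).add (h' z hz)

theorem HasRes.smul {L : PeriodPair} {n : ℕ} {M : Curve L → Mat n} {p : Curve L} {R : Mat n}
    (c : ℂ) (h : HasRes M p R) : HasRes (c • M) p (c • R) := by
  intro z hz
  simpa only [Pi.smul_apply, smul_comm c] using (h z hz).const_smul c

theorem hasRes_zero {L : PeriodPair} {n : ℕ} (p : Curve L) :
    HasRes (0 : Curve L → Mat n) p 0 := by
  intro z _
  simp

namespace Data

variable {L : PeriodPair} {n : ℕ} {T : Data L n}

theorem HasBlocks.add {M N : Curve L → Mat n} (hM : T.HasBlocks M) (hN : T.HasBlocks N) :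
    T.HasBlocks (M + N) where
  mem_so _ := add_mem (hM.mem_so _) (hN.mem_so _)
  blockA j k := add_mem (hM.blockA j k) (hN.blockA j k)
  blockB j k := add_mem (hM.blockB j k) (hN.blockB j k)
  blockC j k := add_mem (hM.blockC j k) (hN.blockC j k)

theorem HasBlocks.smul {M : Curve L → Mat n} (c : ℂ) (hM : T.HasBlocks M) :
    T.HasBlocks (c • M) where
  mem_so _ := (so2n n).smul_mem c (hM.mem_so _)
  blockA j k := Submodule.smul_mem _ c (hM.blockA j k)
  blockB j k := Submodule.smul_mem _ c (hM.blockB j k)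
  blockC j k := Submodule.smul_mem _ c (hM.blockC j k)

theorem hasBlocks_zero : T.HasBlocks 0 where
  mem_so _ := (so2n n).zero_mem
  blockA _ _ := Submodule.zero_mem _
  blockB _ _ := Submodule.zero_mem _
  blockC _ _ := Submodule.zero_mem _

theorem elim_add (a b c d : Fin n → ℂ) :
    Sum.elim (a + c) (b + d) = Sum.elim a b + Sum.elim c d := by
  ext (i | i) <;> rfl

theorem elim_smul (c : ℂ) (a b : Fin n → ℂ) :
    Sum.elim (c • a) (c • b) = c • Sum.elim a b := by
  ext (i | i) <;> rfl

theorem HasTyurinResidues.add {M N : Curve L → Mat n} {μ' μ'' μm ν' ν'' νm : Fin n → Fin n → ℂ}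
    (hM : T.HasTyurinResidues M μ' μ'' μm) (hN : T.HasTyurinResidues N ν' ν'' νm) :
    T.HasTyurinResidues (M + N) (μ' + ν') (μ'' + ν'') (μm + νm) where
  res_q i := by
    have h := (hM.res_q i).add (hN.res_q i)
    rwa [← tyurinResidue_add, ← elim_add] at h
  res_neg_q i := by
    have h := (hM.res_neg_q i).add (hN.res_neg_q i)
    rwa [← tyurinResidue_add, ← elim_add, add_zero] at h

theorem HasTyurinResidues.smul {M : Curve L → Mat n} {μ' μ'' μm : Fin n → Fin n → ℂ} (c : ℂ)
    (hM : T.HasTyurinResidues M μ' μ'' μm) :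
    T.HasTyurinResidues (c • M) (c • μ') (c • μ'') (c • μm) where
  res_q i := by
    have h := (hM.res_q i).smul c
    rwa [← tyurinResidue_smul, ← elim_smul] at h
  res_neg_q i := by
    have h := (hM.res_neg_q i).smul c
    rwa [← tyurinResidue_smul, ← elim_smul, smul_zero] at h

theorem hasTyurinResidues_zero : T.HasTyurinResidues 0 0 0 0 where
  res_q i := by
    have h : Sum.elim ((0 : Fin n → Fin n → ℂ) i) ((0 : Fin n → Fin n → ℂ) i) = 0 := by
      ext (i | i) <;> rfl
    rw [h, tyurinResidue_zero]
    exact hasRes_zero _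
  res_neg_q i := by
    have h : Sum.elim ((0 : Fin n → Fin n → ℂ) i) (0 : Fin n → ℂ) = 0 := by
      ext (i | i) <;> rfl
    rw [h, tyurinResidue_zero]
    exact hasRes_zero _

variable (T)

/-- The space `𝒩ᴰ` of the `so(2n)`-valued `M`-operators with the given blocks. -/
def ND : Submodule ℂ (Curve L → Mat n) where
  carrier := {M | T.HasBlocks M ∧ ∃ μ' μ'' μm, T.HasTyurinResidues M μ' μ'' μm}
  add_mem' := by
    rintro M N ⟨hM, μ', μ'', μm, hMr⟩ ⟨hN, ν', ν'', νm, hNr⟩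
    exact ⟨hM.add hN, _, _, _, hMr.add hNr⟩
  zero_mem' := ⟨hasBlocks_zero, 0, 0, 0, hasTyurinResidues_zero⟩
  smul_mem' := by
    rintro c M ⟨hM, μ', μ'', μm, hMr⟩
    exact ⟨hM.smul c, _, _, _, hMr.smul c⟩

/-- The space of the `M`-operators in `𝒩ᴰ` whose parameters can be chosen such that the motions of
`qᵢ` and of `-qᵢ` agree, i.e. such that their velocities have zero sum for every `i`. -/
def NDlinked : Submodule ℂ (Curve L → Mat n) where
  carrier := {M | T.HasBlocks M ∧ ∃ μ' μ'' μm, T.HasTyurinResidues M μ' μ'' μm ∧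
    ∀ i, T.velPlus μ' μ'' i + T.velMinus μm i = 0}
  add_mem' := by
    rintro M N ⟨hM, μ', μ'', μm, hMr, hv⟩ ⟨hN, ν', ν'', νm, hNr, hw⟩
    refine ⟨hM.add hN, _, _, _, hMr.add hNr, fun i => ?_⟩
    have h1 := hv i
    have h2 := hw i
    simp only [velPlus, velMinus, Pi.add_apply, add_dotProduct] at h1 h2 ⊢
    linear_combination h1 + h2
  zero_mem' := ⟨hasBlocks_zero, 0, 0, 0, hasTyurinResidues_zero, fun i => by
    simp [velPlus, velMinus]⟩
  smul_mem' := by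
    rintro c M ⟨hM, μ', μ'', μm, hMr, hv⟩
    refine ⟨hM.smul c, _, _, _, hMr.smul c, fun i => ?_⟩
    have h1 := hv i
    simp only [velPlus, velMinus, Pi.smul_apply, smul_dotProduct, smul_eq_mul] at h1 ⊢
    linear_combination c * h1

end Data

end EllipticDn

end

noncomputable section

namespace EllipticDn

/-! ### Liouville's theorem for doubly periodic functions and the exclusion of a single simple pole.
-/

section Elliptic

variable {L : PeriodPair}

/-! The dimension is counted by rank-nullity for the map `residues`, which sends `M ∈ 𝒩ᴰ` to its
residues at the points `±qᵢ`.

Kernel (`map_ker_residues`): if all these residues vanish, the simple poles at `±qᵢ` disappear, so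
the kernel is `so(2n) ⊗ H⁰(O(D))`. By Riemann-Roch `h⁰(D) = deg D`, as `D` is effective and nonzero;
the kernel has dimension `dim 𝔤 · deg D`.

Image (`range_residues`): `μ` matters only modulo `α`. At `qᵢ` the block `B` is regular, which
forces `αᵢ' ∧ μᵢ' = 0`, so `μᵢ'` can be normalized to `0`; the remaining `μᵢ''` is free and is
determined by the residue, giving `n` parameters. At `-qᵢ` only `B` has a pole, with residue `α₋ᵢ' ∧
μ₋ᵢ'`, giving `n - 1` parameters. Every such choice occurs, because `h⁰(D + ∑ qᵢ) - h⁰(D) = n` lets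
the residues of each entry be prescribed freely (`exists_residue_section`). The image thus has
dimension `n(2n - 1) = dim 𝔤`, and the total is `dim 𝔤 · (deg D + 1)`.

Riemann-Roch (`finrank_rrSpace`) is proved by induction on the degree. Adding a point raises the
dimension by one because a pole of the new order is realized by `℘`, one of its derivatives, or a
difference of two translates of the zeta function. The induction starts in degree one, where only
constants occur; this is shown by a Riccati equation instead of the residue theorem.

For the linked space, adding `c α₋ᵢ` to `μ₋ᵢ` leaves the residue alone but shifts the velocity by
`-c α₋ᵢ'ᵗ α₋ᵢ'`, so the linking condition can always be met and cuts out nothing (`NDlinked_eq_ND`).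
-/

theorem meromorphicOrderAt_add_lattice {f : ℂ → ℂ} {l : ℂ} (hf : ∀ z, f (z + l) = f z) (z : ℂ) :
    meromorphicOrderAt f (z + l) = meromorphicOrderAt f z := by
  rw [← meromorphicOrderAt_comp_add_const_eq_meromorphicOrderAt]
  congr 1
  exact funext hf

/-- A doubly periodic meromorphic function without poles is constant. -/
theorem exists_const_of_order_nonneg {f : ℂ → ℂ} (hf : Meromorphic f)
    (hper : ∀ l ∈ L.lattice, ∀ z, f (z + l) = f z) (ho : ∀ z, 0 ≤ meromorphicOrderAt f z) :
    ∃ c, ∀ z, f =ᶠ[𝓝[≠] z] fun _ => c := by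
  -- The normal form fills in the removable singularities, so `g` is entire. Its values are limits
  -- of `f`, which is how it inherits the periods.
  set g := toMeromorphicNFOn f Set.univ with hg
  have hfg : ∀ z, f =ᶠ[𝓝[≠] z] g := fun z =>
    (hf.meromorphicOn.toMeromorphicNFOn_eq_self_on_nhdsNE (Set.mem_univ z)).symm
  have hga : ∀ z, AnalyticAt ℂ g z := fun z => by
    have h := meromorphicNFOn_toMeromorphicNFOn f Set.univ (Set.mem_univ z)
    rw [← h.meromorphicOrderAt_nonneg_iff_analyticAt,
      meromorphicOrderAt_toMeromorphicNFOn hf.meromorphicOn (Set.mem_univ z)]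
    exact ho z
  have hlim : ∀ z, Tendsto f (𝓝[≠] z) (𝓝 (g z)) := fun z =>
    ((hga z).continuousAt.tendsto.mono_left nhdsWithin_le_nhds).congr' (hfg z).symm
  have hgper : ∀ z, ∀ l ∈ L.lattice, g (z + l) = g z := by
    intro z l hl
    have h1 : Tendsto (fun w => w + l) (𝓝[≠] z) (𝓝[≠] (z + l)) := by
      refine tendsto_nhdsWithin_of_tendsto_nhds_of_eventually_within _
        ((Continuous.tendsto (by fun_prop) z).mono_left nhdsWithin_le_nhds) ?_
      filter_upwards [self_mem_nhdsWithin] with w hw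
      simpa using hw
    have h2 := (hlim (z + l)).comp h1
    refine tendsto_nhds_unique (h2.congr fun w => hper l hl w) (hlim z)
  have hgd : Differentiable ℂ g := fun z => (hga z).differentiableAt
  -- Periodicity makes the range compact, and Liouville's theorem applies.
  have hb := (IsZLattice.isCompact_range_of_periodic L.lattice g hgd.continuous hgper).isBounded
  refine ⟨g 0, fun z => ?_⟩
  filter_upwards [hfg z] with w hw
  rw [hw]
  exact hgd.apply_eq_apply_of_bounded hb w 0

/-- An analytic function divided by the coordinate, up to its value. -/
theorem exists_eq_add_sub_mul {h : ℂ → ℂ} {z₀ : ℂ} (hh : AnalyticAt ℂ h z₀) :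
    ∃ k : ℂ → ℂ, AnalyticAt ℂ k z₀ ∧ ∀ z, h z = h z₀ + (z - z₀) * k z := by
  obtain ⟨p, hp⟩ := hh
  refine ⟨dslope h z₀, ⟨_, hp.has_fpower_series_dslope_fslope⟩, fun z => ?_⟩
  have := sub_smul_dslope h z₀ z
  simp only [smul_eq_mul] at this
  rw [this]
  ring

/-- Near a simple pole, a function satisfies a Riccati equation up to a regular function. -/
theorem exists_riccati {g : ℂ → ℂ} {z₀ : ℂ} (hg : meromorphicOrderAt g z₀ = (-1 : ℤ)) :
    ∃ c t : ℂ, c ≠ 0 ∧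
      0 ≤ meromorphicOrderAt (fun z => deriv g z + (g z ^ 2 / c - t * g z)) z₀ := by
  have hm : MeromorphicAt g z₀ := meromorphicAt_of_meromorphicOrderAt_ne_zero (by rw [hg]; decide)
  obtain ⟨h, hh, hne, he⟩ := (meromorphicOrderAt_eq_int_iff hm).1 hg
  obtain ⟨h1, hh1, e1⟩ := exists_eq_add_sub_mul hh
  obtain ⟨h2, hh2, e2⟩ := exists_eq_add_sub_mul hh1
  set c := h z₀
  set d := h1 z₀
  -- With `g = c/(z - z₀) + d + ⋯`, the double poles of `g'` and `g²/c` cancel, and `t = 2d/c`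
  -- removes the remaining simple pole `2d/(z - z₀)`.
  refine ⟨c, 2 * d / c, hne, ?_⟩
  have hga : g =ᶠ[𝓝[≠] z₀] fun z => c * (z - z₀)⁻¹ + h1 z := by
    filter_upwards [he, self_mem_nhdsWithin] with z hz hz'
    have : z - z₀ ≠ 0 := sub_ne_zero.2 hz'
    rw [hz, e1 z, _root_.zpow_neg_one, smul_eq_mul]
    field_simp
  have key : (fun z => deriv g z + (g z ^ 2 / c - 2 * d / c * g z)) =ᶠ[𝓝[≠] z₀]
      fun z => 2 * h2 z + deriv h1 z + h1 z ^ 2 / c - 2 * d / c * h1 z := by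
    filter_upwards [hga, hga.nhdsNE_deriv, self_mem_nhdsWithin,
      hh1.eventually_analyticAt.filter_mono nhdsWithin_le_nhds] with z hz hz1 hz2 hz3
    have hz4 : z - z₀ ≠ 0 := sub_ne_zero.2 hz2
    have hd : HasDerivAt (fun z => c * (z - z₀)⁻¹ + h1 z)
        (c * (-1 / (z - z₀) ^ 2) + deriv h1 z) z :=
      ((((hasDerivAt_id z).sub_const z₀).inv hz4).const_mul c).add
        hz3.differentiableAt.hasDerivAt
    rw [hz1, hd.deriv, hz, e2 z]
    field_simp
    ring
  rw [meromorphicOrderAt_congr key]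
  have hh1d := hh1.deriv
  exact AnalyticAt.meromorphicOrderAt_nonneg (by fun_prop)

/-- A doubly periodic meromorphic function does not have exactly one simple pole modulo periods. -/
theorem order_nonneg_of_simple_pole {g : ℂ → ℂ} {z₀ : ℂ} (hg : Meromorphic g)
    (hper : ∀ l ∈ L.lattice, ∀ z, g (z + l) = g z)
    (ho : ∀ z, z - z₀ ∉ L.lattice → 0 ≤ meromorphicOrderAt g z)
    (h1 : (-1 : ℤ) ≤ meromorphicOrderAt g z₀) : 0 ≤ meromorphicOrderAt g z₀ := by
  by_contra hneg
  have hord : meromorphicOrderAt g z₀ = (-1 : ℤ) := by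
    revert h1 hneg
    cases meromorphicOrderAt g z₀ with
    | top => simp
    | coe a =>
      intro h1 hneg
      norm_cast at *
      omega
  have red : ∀ {f : ℂ → ℂ}, (∀ l ∈ L.lattice, ∀ z, f (z + l) = f z) → ∀ z, z - z₀ ∈ L.lattice →
      meromorphicOrderAt f z = meromorphicOrderAt f z₀ := fun hf z hz => by
    have := meromorphicOrderAt_add_lattice (hf _ hz) z₀
    rwa [add_sub_cancel] at this
  obtain ⟨c, t, hc, hG⟩ := exists_riccati hord
  have hdper : ∀ l ∈ L.lattice, ∀ z, deriv g (z + l) = deriv g z := fun l hl z => by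
    rw [← deriv_comp_add_const]
    congr 1
    exact funext (hper l hl)
  have hmd : Meromorphic (deriv g) := hg.deriv
  have hreg : ∀ a b : ℂ, ∀ z, z - z₀ ∉ L.lattice →
      0 ≤ meromorphicOrderAt (fun z => a * g z + b) z := by
    intro a b z hz
    obtain ⟨h, hh, hgh⟩ := ((hg z).meromorphicOrderAt_nonneg_iff).1 (ho z hz)
    rw [meromorphicOrderAt_congr (f₂ := fun z => a * h z + b)
      (by filter_upwards [hgh] with w hw; rw [hw])]
    exact AnalyticAt.meromorphicOrderAt_nonneg (by fun_prop)
  -- The Riccati expression has no pole left, neither at the translates of `z₀` nor elsewhere, so it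
  -- is a constant `k`.
  obtain ⟨k, hk⟩ := exists_const_of_order_nonneg (L := L)
    (f := fun z => deriv g z + (g z ^ 2 / c - t * g z)) (by fun_prop)
    (fun l hl z => by rw [hdper l hl, hper l hl]) (fun z => by
      by_cases hz : z - z₀ ∈ L.lattice
      · rwa [red (fun l hl z => by rw [hdper l hl, hper l hl]) z hz]
      · obtain ⟨h, hh, hgh⟩ := ((hg z).meromorphicOrderAt_nonneg_iff).1 (ho z hz)
        rw [meromorphicOrderAt_congr (f₂ := fun z => deriv h z + (h z ^ 2 / c - t * h z))
          (by filter_upwards [hgh, hgh.nhdsNE_deriv] with w hw hw'; rw [hw, hw'])]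
        have := hh.deriv
        exact AnalyticAt.meromorphicOrderAt_nonneg (by fun_prop))
  -- A constant solution `r` of the Riccati equation: then `u = g - r` satisfies the linear equation
  -- `u' = u (-g/c + t - r/c)`.
  obtain ⟨r, hr⟩ : ∃ r : ℂ, r ^ 2 / c - t * r = k := by
    obtain ⟨s, hs⟩ := IsAlgClosed.exists_pow_nat_eq (k * c + (t * c / 2) ^ 2) (n := 2) (by norm_num)
    refine ⟨s + t * c / 2, ?_⟩
    field_simp
    linear_combination 4 * hs
  set u : ℂ → ℂ := fun z => g z - r with hu
  have hum : Meromorphic u := by fun_prop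
  have huper : ∀ l ∈ L.lattice, ∀ z, u (z + l) = u z := fun l hl z => by simp only [hu, hper l hl]
  have hu0 : meromorphicOrderAt u z₀ = (-1 : ℤ) := by
    have : u = g + fun _ => -r := by ext; simp [hu, sub_eq_add_neg]
    rw [this, meromorphicOrderAt_add_eq_left_of_lt (by fun_prop), hord]
    rw [hord]
    exact lt_of_lt_of_le (by decide) (analyticAt_const.meromorphicOrderAt_nonneg)
  have hutop : ∀ z, meromorphicOrderAt u z ≠ ⊤ := fun z =>
    hum.meromorphicOn.meromorphicOrderAt_ne_top_of_isPreconnected (U := Set.univ)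
      isPreconnected_univ (Set.mem_univ z₀) (Set.mem_univ z) (by rw [hu0]; exact WithTop.coe_ne_top)
  -- A zero of `u` would be a simple pole of `u'/u = -g/c + t - r/c`, which is regular away from the
  -- translates of `z₀`.
  have hule : ∀ z, meromorphicOrderAt u z ≤ 0 := by
    intro z
    by_cases hz : z - z₀ ∈ L.lattice
    · rw [red huper z hz, hu0]; decide
    by_contra hpos
    push Not at hpos
    have hlog := meromorphicOrderAt_logDeriv_eq_neg_one (hum z) hpos.ne' (hutop z)
    have hv : logDeriv u =ᶠ[𝓝[≠] z] fun z => (-1 / c) * g z + (t - r / c) := by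
      filter_upwards [hk z, (meromorphicOrderAt_ne_top_iff_eventually_ne_zero (hum z)).1 (hutop z)]
        with w hw hw'
      have hd : deriv u w = deriv g w := by simp [hu]
      rw [logDeriv_apply, hd, div_eq_iff hw']
      simp only [hu]
      field_simp at hw hr ⊢
      linear_combination hw - hr
    rw [meromorphicOrderAt_congr hv] at hlog
    have := hreg (-1 / c) (t - r / c) z hz
    rw [hlog] at this
    exact absurd this (by decide)
  -- Hence `u⁻¹` has no poles and is constant, although it has a simple zero at `z₀`.
  obtain ⟨b, hb⟩ := exists_const_of_order_nonneg (L := L) (f := u⁻¹) hum.inv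
    (fun l hl z => by simp [huper l hl]) (fun z => by
      rw [meromorphicOrderAt_inv]
      have h1 := hule z
      have h2 := hutop z
      revert h1 h2
      cases meromorphicOrderAt u z with
      | top => simp
      | coe a => intro h1 _; norm_cast at *; omega)
  have h2 := meromorphicOrderAt_congr (hb z₀)
  rw [meromorphicOrderAt_inv, hu0, meromorphicOrderAt_const] at h2
  split_ifs at h2 with h
  all_goals exact absurd h2 (by decide)

end Elliptic

/-! ### The Weierstrass zeta function and doubly periodic functions with prescribed pole orders. -/

section Zeta

open PeriodPair

variable (L : PeriodPair)

/-- A summand of the Weierstrass zeta function. -/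
def zetaTerm (l z : ℂ) : ℂ := 1 / (z - l) + 1 / l + z / l ^ 2

/-- The Weierstrass zeta function with the summand at `l₀` missing. -/
def zetaExcept (l₀ z : ℂ) : ℂ := ∑' l : L.lattice, if l.1 = l₀ then 0 else zetaTerm l z

/-- The Weierstrass zeta function. -/
def zeta (z : ℂ) : ℂ := ∑' l : L.lattice, zetaTerm l z

theorem norm_zetaTerm_le {r : ℝ} (hr : 0 < r) {s : ℂ} (hs : ‖s‖ < r) {l : ℂ} (h : 2 * r ≤ ‖l‖) :
    ‖zetaTerm l s‖ ≤ 2 * r ^ 2 * ‖l‖ ^ (-3 : ℝ) := by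
  have hl : 0 < ‖l‖ := by linarith
  have hl0 : l ≠ 0 := norm_pos_iff.1 hl
  have hsl : ‖l‖ / 2 ≤ ‖s - l‖ := by
    rw [norm_sub_rev]
    exact .trans (by linarith) (norm_sub_norm_le l s)
  have hsl0 : s - l ≠ 0 := norm_pos_iff.1 (by linarith)
  -- The correction terms cancel the expansion of `1 / (s - l)` through first order in `s`, leaving
  -- decay like `‖l‖⁻³`, which is summable over a lattice of rank two.
  have e : zetaTerm l s = s ^ 2 / ((s - l) * l ^ 2) := by
    rw [zetaTerm]
    field_simp
    ring
  calc ‖zetaTerm l s‖ = ‖s‖ ^ 2 / (‖s - l‖ * ‖l‖ ^ 2) := by rw [e]; simp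
    _ ≤ r ^ 2 / (‖l‖ / 2 * ‖l‖ ^ 2) := by gcongr
    _ = 2 * r ^ 2 / ‖l‖ ^ 3 := by field
    _ = _ := by norm_cast

theorem hasSumLocallyUniformly_zetaExcept (l₀ : ℂ) :
    HasSumLocallyUniformly
      (fun (l : L.lattice) (z : ℂ) => if l.1 = l₀ then 0 else zetaTerm l z)
      (zetaExcept L l₀) := by
  refine L.hasSumLocallyUniformly_aux (u := fun r l => 2 * r ^ 2 * ‖l‖ ^ (-3 : ℝ)) _
    (fun _ _ => (ZLattice.summable_norm_rpow _ _ (by simp; norm_num)).mul_left _) fun r hr =>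
    Filter.eventually_atTop.mpr ⟨2 * r, ?_⟩
  rintro _ h s hs l rfl
  split_ifs
  · rw [norm_zero]
    positivity
  · exact norm_zetaTerm_le hr hs h

theorem hasDerivAt_zetaTerm {l z : ℂ} (h : z ≠ l) :
    HasDerivAt (zetaTerm l) (-(1 / (z - l) ^ 2 - 1 / l ^ 2)) z := by
  have h0 : z - l ≠ 0 := sub_ne_zero.2 h
  have h1 := ((((hasDerivAt_id z).sub_const l).inv h0).add_const (1 / l)).add
    ((hasDerivAt_id z).div_const (l ^ 2))
  refine (h1.congr_of_eventuallyEq (.of_forall fun w => ?_)).congr_deriv ?_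
  · simp [zetaTerm]
  · simp only [id]
    ring

theorem differentiableAt_zetaExceptTerm {l₀ z : ℂ} (hz : z ∈ ((L.lattice : Set ℂ) \ {l₀})ᶜ)
    (l : L.lattice) :
    DifferentiableAt ℂ (fun z => if l.1 = l₀ then 0 else zetaTerm l z) z := by
  split_ifs with hl
  · simp
  · exact (hasDerivAt_zetaTerm (by rintro rfl; exact hz ⟨l.2, hl⟩)).differentiableAt

theorem differentiableOn_zetaExcept (l₀ : ℂ) :
    DifferentiableOn ℂ (zetaExcept L l₀) ((L.lattice : Set ℂ) \ {l₀})ᶜ :=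
  (hasSumLocallyUniformly_zetaExcept L l₀).hasSumLocallyUniformlyOn.differentiableOn
    (.of_forall fun _ => .fun_sum fun l _ _ hz =>
      (differentiableAt_zetaExceptTerm L hz l).differentiableWithinAt)
    L.isOpen_compl_lattice_sdiff

/-- Locally uniform convergence permits termwise differentiation, and each summand differentiates to
minus the corresponding summand of `℘`. -/
theorem deriv_zetaExcept (l₀ : ℂ) :
    Set.EqOn (deriv (zetaExcept L l₀)) (fun z => -weierstrassPExcept L l₀ z)
      ((L.lattice : Set ℂ) \ {l₀})ᶜ := by
  refine ((hasSumLocallyUniformly_zetaExcept L l₀).tendstoLocallyUniformlyOn.deriv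
    (.of_forall fun s => .fun_sum fun l _ _ hz =>
      (differentiableAt_zetaExceptTerm L hz l).differentiableWithinAt)
    L.isOpen_compl_lattice_sdiff).unique ?_
  refine ((L.hasSumLocallyUniformly_weierstrassPExcept l₀).tendstoLocallyUniformlyOn
    (s := ((L.lattice : Set ℂ) \ {l₀})ᶜ)).neg.congr ?_
  intro s z hz
  simp only [Function.comp_apply, Pi.neg_apply]
  rw [deriv_fun_sum fun l _ => differentiableAt_zetaExceptTerm L hz l, ← Finset.sum_neg_distrib]
  refine Finset.sum_congr rfl fun l _ => ?_
  split_ifs with hl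
  · simp
  · exact ((hasDerivAt_zetaTerm (by rintro rfl; exact hz ⟨l.2, hl⟩)).deriv).symm

theorem zetaExcept_add {l₀ : ℂ} (hl₀ : l₀ ∈ L.lattice) (z : ℂ) :
    zetaExcept L l₀ z + zetaTerm l₀ z = zeta L z := by
  trans zetaExcept L l₀ z + ∑' i : L.lattice, if i = (⟨l₀, hl₀⟩ : L.lattice) then zetaTerm l₀ z else 0
  · simp
  rw [zetaExcept, ← Summable.tsum_add]
  · congr with w
    by_cases h : w = ⟨l₀, hl₀⟩
    · simp [h]
    · have : w.1 ≠ l₀ := fun h' => h (Subtype.ext h')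
      simp [h, this]
  · exact ⟨_, (hasSumLocallyUniformly_zetaExcept L l₀).hasSum⟩
  · exact summable_of_hasFiniteSupport ((Set.finite_singleton (⟨l₀, hl₀⟩ : L.lattice)).subset
      (by simp))

theorem hasDerivAt_zeta {z : ℂ} (hz : z ∉ L.lattice) : HasDerivAt (zeta L) (-weierstrassP L z) z := by
  -- The half period `ω₁ / 2` is not a lattice point, so excluding it omits no summand and the
  -- results on `zetaExcept` apply to `zeta`.
  have hz' : z ∈ ((L.lattice : Set ℂ) \ {L.ω₁ / 2})ᶜ := fun h => hz h.1
  have e : zeta L = zetaExcept L (L.ω₁ / 2) := by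
    ext w
    refine tsum_congr fun l => ?_
    rw [if_neg]
    exact fun e => L.ω₁_div_two_notMem_lattice (e ▸ l.2)
  have h := ((differentiableOn_zetaExcept L (L.ω₁ / 2)).differentiableAt
    (L.isOpen_compl_lattice_sdiff.mem_nhds hz')).hasDerivAt
  rw [deriv_zetaExcept L _ hz', L.weierstrassPExcept_of_notMem _ L.ω₁_div_two_notMem_lattice] at h
  rwa [e]

theorem analyticAt_zeta {z : ℂ} (hz : z ∉ L.lattice) : AnalyticAt ℂ (zeta L) z :=
  DifferentiableOn.analyticAt (s := (L.lattice : Set ℂ)ᶜ)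
    (fun _ hw => (hasDerivAt_zeta L hw).differentiableAt.differentiableWithinAt)
    (L.isClosed_lattice.isOpen_compl.mem_nhds hz)

theorem zeta_eq_inv_add {l₀ : ℂ} (hl₀ : l₀ ∈ L.lattice) :
    ∃ h : ℂ → ℂ, AnalyticAt ℂ h l₀ ∧ ∀ z, zeta L z = (z - l₀)⁻¹ + h z := by
  refine ⟨fun z => zetaExcept L l₀ z + (1 / l₀ + z / l₀ ^ 2), ?_, fun z => ?_⟩
  · have h : AnalyticAt ℂ (zetaExcept L l₀) l₀ :=
      (differentiableOn_zetaExcept L l₀).analyticAt (L.compl_lattice_sdiff_singleton_mem_nhds l₀)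
    have h2 : AnalyticAt ℂ (fun z : ℂ => 1 / l₀ + z / l₀ ^ 2) l₀ := by
      simp only [div_eq_mul_inv]
      fun_prop
    exact h.add h2
  · rw [← zetaExcept_add L hl₀, zetaTerm]
    ring

theorem meromorphic_zeta : Meromorphic (zeta L) := fun z => by
  by_cases hz : z ∈ L.lattice
  · obtain ⟨h, hh, he⟩ := zeta_eq_inv_add L hz
    rw [funext he]
    have := hh.meromorphicAt
    fun_prop
  · exact (analyticAt_zeta L hz).meromorphicAt

/-- Both `ζ(z + l)` and `ζ(z)` have derivative `-℘(z)`, and the complement of the countable lattice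
is connected, so their difference is constant. -/
theorem exists_quasiPeriod {l : ℂ} (hl : l ∈ L.lattice) :
    ∃ η, ∀ z, z ∉ L.lattice → zeta L (z + l) = zeta L z + η := by
  have hmem : ∀ z, z ∉ L.lattice → z + l ∉ L.lattice := fun z hz h =>
    hz (by simpa using sub_mem h hl)
  have hz₀ := L.ω₁_div_two_notMem_lattice
  refine ⟨zeta L (L.ω₁ / 2 + l) - zeta L (L.ω₁ / 2), fun z hz => ?_⟩
  have hd : ∀ z, z ∉ L.lattice → HasDerivAt (fun z => zeta L (z + l)) (-weierstrassP L z) z := by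
    intro z hz
    have := (hasDerivAt_zeta L (hmem z hz)).comp_add_const z l
    rwa [L.weierstrassP_add_coe z ⟨l, hl⟩] at this
  have key := IsOpen.eqOn_of_deriv_eq (𝕜 := ℂ) (s := (L.lattice : Set ℂ)ᶜ)
    (f := fun z => zeta L (z + l))
    (g := fun z => zeta L z + (zeta L (L.ω₁ / 2 + l) - zeta L (L.ω₁ / 2)))
    L.isClosed_lattice.isOpen_compl
    (Set.Countable.isConnected_compl_of_one_lt_rank (by simp)
      (countable_of_Lindelof_of_discrete (X := L.lattice))).2
    (fun w hw => (hd w hw).differentiableAt.differentiableWithinAt)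
    (fun w hw => ((hasDerivAt_zeta L hw).add_const _).differentiableAt.differentiableWithinAt)
    (fun w hw => by rw [(hd w hw).deriv, ((hasDerivAt_zeta L hw).add_const _).deriv])
    hz₀ (by ring)
  exact key hz

open Classical in
/-- A doubly periodic function with simple poles at `a` and `b` modulo periods. -/
def zetaDiff (a b z : ℂ) : ℂ :=
  -- The default `0` at the poles makes the periodicity exact at every point; the quasi-period
  -- identity is only available off the lattice.
  if z - a ∈ L.lattice ∨ z - b ∈ L.lattice then 0 else zeta L (z - a) - zeta L (z - b)

variable {L}

/-- Both translates of `ζ` gain the same quasi-period, which cancels in the difference. -/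
theorem zetaDiff_add_lattice (a b : ℂ) {l : ℂ} (hl : l ∈ L.lattice) (z : ℂ) :
    zetaDiff L a b (z + l) = zetaDiff L a b z := by
  obtain ⟨η, hη⟩ := exists_quasiPeriod L hl
  have hm : ∀ c, z + l - c ∈ L.lattice ↔ z - c ∈ L.lattice := fun c => by
    rw [add_sub_right_comm]
    exact L.lattice.add_mem_iff_left hl
  by_cases h : z - a ∈ L.lattice ∨ z - b ∈ L.lattice
  · rw [zetaDiff, zetaDiff, if_pos h, if_pos (by rwa [hm, hm])]
  · rw [zetaDiff, zetaDiff, if_neg h, if_neg (by rwa [hm, hm])]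
    push Not at h
    rw [add_sub_right_comm, hη _ h.1, add_sub_right_comm z l b, hη _ h.2]
    ring

theorem eventually_notMem_lattice (a z : ℂ) : ∀ᶠ w in 𝓝[≠] z, w - a ∉ L.lattice := by
  have h : Tendsto (fun w => w - a) (𝓝 z) (𝓝 (z - a)) := Continuous.tendsto (by fun_prop) z
  filter_upwards [(h.eventually
    (L.compl_lattice_sdiff_singleton_mem_nhds (z - a))).filter_mono nhdsWithin_le_nhds,
    self_mem_nhdsWithin] with w hw hw' hmem
  exact hw ⟨hmem, fun h => hw' (sub_left_injective (Set.mem_singleton_iff.1 h))⟩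

theorem zetaDiff_eventuallyEq (a b z : ℂ) :
    zetaDiff L a b =ᶠ[𝓝[≠] z] fun z => zeta L (z - a) - zeta L (z - b) := by
  filter_upwards [eventually_notMem_lattice (L := L) a z, eventually_notMem_lattice (L := L) b z]
    with w h1 h2
  simp [zetaDiff, h1, h2]

theorem analyticAt_zeta_sub {a z : ℂ} (h : z - a ∉ L.lattice) :
    AnalyticAt ℂ (fun z => zeta L (z - a)) z :=
  (analyticAt_zeta L h).fun_comp (f := fun z => z - a) (by fun_prop)

theorem analyticAt_zetaDiff {a b z : ℂ} (h1 : z - a ∉ L.lattice) (h2 : z - b ∉ L.lattice) :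
    AnalyticAt ℂ (zetaDiff L a b) z := by
  refine ((analyticAt_zeta_sub h1).sub (analyticAt_zeta_sub h2)).congr ?_
  have ht : ∀ c, Tendsto (fun w => w - c) (𝓝 z) (𝓝 (z - c)) := fun c =>
    Continuous.tendsto (by fun_prop) z
  filter_upwards [(ht a).eventually (L.isClosed_lattice.isOpen_compl.mem_nhds h1),
    (ht b).eventually (L.isClosed_lattice.isOpen_compl.mem_nhds h2)] with w h1 h2
  have h1 : w - a ∉ L.lattice := h1
  have h2 : w - b ∉ L.lattice := h2
  simp [zetaDiff, h1, h2]

theorem meromorphic_zetaDiff (a b : ℂ) : Meromorphic (zetaDiff L a b) := fun z => by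
  refine MeromorphicAt.congr ?_ (zetaDiff_eventuallyEq a b z).symm
  exact ((meromorphic_zeta L (z - a)).comp_analyticAt (g := fun z => z - a) (by fun_prop)).sub
    ((meromorphic_zeta L (z - b)).comp_analyticAt (g := fun z => z - b) (by fun_prop))

theorem meromorphicOrderAt_zeta {l : ℂ} (hl : l ∈ L.lattice) :
    meromorphicOrderAt (zeta L) l = (-1 : ℤ) := by
  obtain ⟨h, hh, he⟩ := zeta_eq_inv_add L hl
  rw [meromorphicOrderAt_eq_int_iff (meromorphic_zeta L l)]
  refine ⟨fun z => 1 + (z - l) * h z, by fun_prop, by simp, ?_⟩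
  filter_upwards [self_mem_nhdsWithin] with z hz
  have : z - l ≠ 0 := sub_ne_zero.2 hz
  rw [he, _root_.zpow_neg_one, smul_eq_mul]
  field_simp

theorem meromorphicOrderAt_zeta_sub {a z : ℂ} (hz : z - a ∈ L.lattice) :
    meromorphicOrderAt (fun z => zeta L (z - a)) z = (-1 : ℤ) := by
  rw [← meromorphicOrderAt_zeta hz]
  exact meromorphicOrderAt_comp_sub_const_eq_meromorphicOrderAt (f := zeta L)

theorem meromorphicAt_zeta_sub (a z : ℂ) : MeromorphicAt (fun z => zeta L (z - a)) z :=
  (meromorphic_zeta L (z - a)).comp_analyticAt (g := fun z => z - a) (by fun_prop)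

theorem meromorphicOrderAt_zetaDiff_left {a b z : ℂ} (h1 : z - a ∈ L.lattice)
    (h2 : z - b ∉ L.lattice) : meromorphicOrderAt (zetaDiff L a b) z = (-1 : ℤ) := by
  have h : meromorphicOrderAt (fun z => zeta L (z - a)) z <
      meromorphicOrderAt (-fun z => zeta L (z - b)) z := by
    rw [meromorphicOrderAt_zeta_sub h1]
    exact lt_of_lt_of_le (by decide) (analyticAt_zeta_sub h2).neg.meromorphicOrderAt_nonneg
  rw [meromorphicOrderAt_congr (zetaDiff_eventuallyEq a b z), ← meromorphicOrderAt_zeta_sub h1,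
    ← meromorphicOrderAt_add_eq_left_of_lt (meromorphicAt_zeta_sub b z).neg h]
  rfl

theorem zetaDiff_swap (a b : ℂ) : zetaDiff L b a = -zetaDiff L a b := by
  ext z
  by_cases h : z - a ∈ L.lattice ∨ z - b ∈ L.lattice
  · rw [Pi.neg_apply, zetaDiff, zetaDiff, if_pos h, if_pos h.symm, neg_zero]
  · rw [Pi.neg_apply, zetaDiff, zetaDiff, if_neg h, if_neg (mt Or.symm h), neg_sub]

theorem meromorphicOrderAt_zetaDiff_right {a b z : ℂ} (h1 : z - a ∉ L.lattice)
    (h2 : z - b ∈ L.lattice) : meromorphicOrderAt (zetaDiff L a b) z = (-1 : ℤ) := by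
  rw [zetaDiff_swap b a, ← meromorphicOrderAt_neg, meromorphicOrderAt_zetaDiff_left h2 h1]

/-- For `m ≥ 2`, a doubly periodic function with a pole of order `m` at the lattice points. -/
theorem exists_pole_of_order (L : PeriodPair) {m : ℕ} (hm : 2 ≤ m) :
    ∃ f : ℂ → ℂ, Meromorphic f ∧ (∀ l ∈ L.lattice, ∀ z, f (z + l) = f z) ∧
      (∀ z, z ∉ L.lattice → AnalyticAt ℂ f z) ∧
      ∀ l ∈ L.lattice, meromorphicOrderAt f l = ((-m : ℤ) : WithTop ℤ) := by
  -- Start from `℘`; each differentiation raises the pole order by one.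
  induction m, hm using Nat.le_induction with
  | base =>
    exact ⟨weierstrassP L, L.meromorphic_weierstrassP,
      fun l hl z => L.weierstrassP_add_coe z ⟨l, hl⟩, fun z hz => L.analyticOnNhd_weierstrassP z hz,
      fun l hl => by rw [L.order_weierstrassP l hl]; rfl⟩
  | succ k hk ih =>
    obtain ⟨f, h1, h2, h3, h4⟩ := ih
    refine ⟨deriv f, h1.deriv, fun l hl z => ?_, fun z hz => (h3 z hz).deriv, fun l hl => ?_⟩
    · rw [← deriv_comp_add_const]
      congr 1
      exact funext (h2 l hl)
    · rw [meromorphicOrderAt_deriv_eq_sub_one (n := -k) _ (h4 l hl)]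
      · congr 1
        push_cast
        ring
      · push_cast
        simp
        omega

end Zeta

/-! ### Riemann-Roch for effective divisors of positive degree. -/

section RiemannRoch

variable {L : PeriodPair}

theorem proj_eq_proj_iff {z w : ℂ} : proj L z = proj L w ↔ z - w ∈ L.lattice :=
  Submodule.Quotient.eq _

theorem proj_add_lattice {l : ℂ} (hl : l ∈ L.lattice) (z : ℂ) : proj L (z + l) = proj L z := by
  rw [proj_eq_proj_iff]
  simpa using hl

theorem proj_surjective (p : Curve L) : ∃ z, proj L z = p := Submodule.Quotient.mk_surjective _ p

theorem eventually_proj_notMem {S : Set (Curve L)} (hS : S.Finite) (z : ℂ) :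
    ∀ᶠ w in 𝓝[≠] z, proj L w ∉ S := by
  have h : ∀ p ∈ S, ∀ᶠ w in 𝓝[≠] z, proj L w ≠ p := by
    intro p _
    obtain ⟨a, rfl⟩ := proj_surjective p
    filter_upwards [eventually_notMem_lattice (L := L) a z] with w hw
    rwa [Ne, proj_eq_proj_iff]
  filter_upwards [(Filter.eventually_all_finite hS).2 h] with w hw hmem
  exact hw _ hmem rfl

/-- Doubly periodic functions give elements of Riemann-Roch spaces. -/
theorem exists_mem_rrSpace {S : Set (Curve L)} (hS : S.Finite) {Δ : Curve L →₀ ℤ} {F : ℂ → ℂ}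
    (hF : Meromorphic F) (hper : ∀ l ∈ L.lattice, ∀ z, F (z + l) = F z)
    (han : ∀ z, proj L z ∉ S → AnalyticAt ℂ F z)
    (ho : ∀ z, ((-(Δ (proj L z)) : ℤ) : WithTop ℤ) ≤ meromorphicOrderAt F z) :
    ∃ f ∈ rrSpace L S Δ, ∀ z, (fun w => f (proj L w)) =ᶠ[𝓝[≠] z] F := by
  classical
  set f : Curve L → ℂ := fun p => if p ∈ S then 0 else F (proj_surjective p).choose with hf
  have hval : ∀ w, proj L w ∉ S → f (proj L w) = F w := by
    intro w hw
    rw [hf]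
    simp only [if_neg hw]
    have h := (proj_surjective (proj L w)).choose_spec
    rw [proj_eq_proj_iff] at h
    have := hper _ h w
    rwa [add_sub_cancel] at this
  have heq : ∀ z, (fun w => f (proj L w)) =ᶠ[𝓝[≠] z] F := fun z => by
    filter_upwards [eventually_proj_notMem hS z] with w hw using hval w hw
  refine ⟨f, ⟨fun p hp => if_pos hp, fun z hz => (han z hz).congr ?_, fun z =>
    ⟨(hF z).congr (heq z).symm, ?_⟩⟩, heq⟩
  · filter_upwards [eventually_nhdsWithin_iff.1 (heq z)] with w hw
    by_cases h : w = z
    · rw [h, hval z hz]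
    · exact (hw h).symm
  · rw [meromorphicOrderAt_congr (heq z)]
    exact ho z

/-- The leading coefficient of `f` at `z₀`, for functions with a pole of order at most `m`. -/
def leadCoeff (z₀ : ℂ) (m : ℤ) (f : Curve L → ℂ) : ℂ :=
  limUnder (𝓝[≠] z₀) fun w => (w - z₀) ^ m * f (proj L w)

theorem meromorphicOrderAt_zpow_mul {g : ℂ → ℂ} {z₀ : ℂ} (m : ℤ) (hg : MeromorphicAt g z₀) :
    MeromorphicAt (fun w => (w - z₀) ^ m * g w) z₀ ∧
      meromorphicOrderAt (fun w => (w - z₀) ^ m * g w) z₀ = m + meromorphicOrderAt g z₀ := by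
  have h1 : MeromorphicAt (fun w => (w - z₀) ^ m) z₀ := by fun_prop
  refine ⟨h1.mul hg, ?_⟩
  have h2 : meromorphicOrderAt (fun w => (w - z₀) ^ m) z₀ = m :=
    meromorphicOrderAt_zpow_id_sub_const
  rw [← h2]
  exact meromorphicOrderAt_mul h1 hg

/-- The product has nonnegative order, so the limit exists and `limUnder` is not a default value. -/
theorem tendsto_leadCoeff {f : Curve L → ℂ} {z₀ : ℂ} {m : ℤ}
    (hf : MeromorphicAt (fun w => f (proj L w)) z₀)
    (h : ((-m : ℤ) : WithTop ℤ) ≤ meromorphicOrderAt (fun w => f (proj L w)) z₀) :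
    Tendsto (fun w => (w - z₀) ^ m * f (proj L w)) (𝓝[≠] z₀) (𝓝 (leadCoeff z₀ m f)) := by
  obtain ⟨h1, h2⟩ := meromorphicOrderAt_zpow_mul m hf
  have h3 : 0 ≤ meromorphicOrderAt (fun w => (w - z₀) ^ m * f (proj L w)) z₀ := by
    rw [h2]
    revert h
    cases meromorphicOrderAt (fun w => f (proj L w)) z₀ with
    | top => simp
    | coe a => intro h; norm_cast at *; omega
  exact tendsto_nhds_limUnder ((tendsto_nhds_iff_meromorphicOrderAt_nonneg h1).2 h3)

/-- The coefficient is the limit of `(w - z₀)ᵐ f`; it vanishes exactly when this product has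
positive order. -/
theorem leadCoeff_eq_zero_iff {f : Curve L → ℂ} {z₀ : ℂ} {m : ℤ}
    (hf : MeromorphicAt (fun w => f (proj L w)) z₀)
    (h : ((-m : ℤ) : WithTop ℤ) ≤ meromorphicOrderAt (fun w => f (proj L w)) z₀) :
    leadCoeff z₀ m f = 0 ↔
      ((-(m - 1) : ℤ) : WithTop ℤ) ≤ meromorphicOrderAt (fun w => f (proj L w)) z₀ := by
  obtain ⟨h1, h2⟩ := meromorphicOrderAt_zpow_mul m hf
  have ht := tendsto_leadCoeff hf h
  trans 0 < meromorphicOrderAt (fun w => (w - z₀) ^ m * f (proj L w)) z₀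
  · rw [← tendsto_zero_iff_meromorphicOrderAt_pos h1]
    exact ⟨fun h => by rwa [h] at ht, fun h => tendsto_nhds_unique ht h⟩
  · rw [h2]
    cases meromorphicOrderAt (fun w => f (proj L w)) z₀ with
    | top => simp
    | coe a => norm_cast; omega

theorem leadCoeff_add {f g : Curve L → ℂ} {z₀ : ℂ} {m : ℤ} {a b : ℂ}
    (hf : Tendsto (fun w => (w - z₀) ^ m * f (proj L w)) (𝓝[≠] z₀) (𝓝 a))
    (hg : Tendsto (fun w => (w - z₀) ^ m * g (proj L w)) (𝓝[≠] z₀) (𝓝 b)) :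
    leadCoeff z₀ m (f + g) = a + b := by
  refine Tendsto.limUnder_eq ((hf.add hg).congr fun w => ?_)
  simp only [Pi.add_apply]
  ring

theorem leadCoeff_smul {f : Curve L → ℂ} {z₀ : ℂ} {m : ℤ} {a : ℂ} (c : ℂ)
    (hf : Tendsto (fun w => (w - z₀) ^ m * f (proj L w)) (𝓝[≠] z₀) (𝓝 a)) :
    leadCoeff z₀ m (c • f) = c * a := by
  refine Tendsto.limUnder_eq ((hf.const_mul c).congr fun w => ?_)
  simp only [Pi.smul_apply, smul_eq_mul]
  ring

variable (S : Set (Curve L)) (Δ : Curve L →₀ ℤ)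

variable {S Δ} in
theorem tendsto_leadCoeff_of_mem {f : Curve L → ℂ} (hf : f ∈ rrSpace L S Δ) (z₀ : ℂ) :
    Tendsto (fun w => (w - z₀) ^ Δ (proj L z₀) * f (proj L w)) (𝓝[≠] z₀)
      (𝓝 (leadCoeff z₀ (Δ (proj L z₀)) f)) :=
  tendsto_leadCoeff (hf.2.2 z₀).1 (hf.2.2 z₀).2

/-- The leading coefficient at `z₀` as a linear form on a Riemann-Roch space. -/
def leadCoeffMap (z₀ : ℂ) : rrSpace L S Δ →ₗ[ℂ] ℂ where
  toFun f := leadCoeff z₀ (Δ (proj L z₀)) f.1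
  map_add' f g := leadCoeff_add (tendsto_leadCoeff_of_mem f.2 z₀) (tendsto_leadCoeff_of_mem g.2 z₀)
  map_smul' c f := leadCoeff_smul c (tendsto_leadCoeff_of_mem f.2 z₀)

variable {S Δ}

theorem rrSpace_mono {Δ' : Curve L →₀ ℤ} (h : Δ' ≤ Δ) : rrSpace L S Δ' ≤ rrSpace L S Δ :=
  fun f hf => ⟨hf.1, hf.2.1, fun z => ⟨(hf.2.2 z).1, le_trans (by
    have := h (proj L z)
    norm_cast
    omega) (hf.2.2 z).2⟩⟩

theorem order_eq_of_proj_eq (f : Curve L → ℂ) {z w : ℂ} (h : proj L z = proj L w) :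
    meromorphicOrderAt (fun w => f (proj L w)) z = meromorphicOrderAt (fun w => f (proj L w)) w := by
  rw [proj_eq_proj_iff] at h
  have := meromorphicOrderAt_add_lattice (f := fun w => f (proj L w))
    (fun z => by rw [proj_add_lattice h]) w
  rwa [add_sub_cancel] at this

theorem leadCoeff_eq_zero_iff_mem {f : Curve L → ℂ} (hf : f ∈ rrSpace L S Δ) (z₀ : ℂ) :
    leadCoeff z₀ (Δ (proj L z₀)) f = 0 ↔ f ∈ rrSpace L S (Δ - Finsupp.single (proj L z₀) 1) := by
  classical
  rw [leadCoeff_eq_zero_iff (hf.2.2 z₀).1 (hf.2.2 z₀).2]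
  constructor
  · refine fun h => ⟨hf.1, hf.2.1, fun z => ⟨(hf.2.2 z).1, ?_⟩⟩
    rw [Finsupp.sub_apply, Finsupp.single_apply]
    split_ifs with hz
    · rwa [order_eq_of_proj_eq f hz.symm, ← hz]
    · simpa using (hf.2.2 z).2
  · intro h
    simpa using (h.2.2 z₀).2

theorem finite_of_finite_ker {V W : Type*} [AddCommGroup V] [Module ℂ V] [AddCommGroup W]
    [Module ℂ W] [FiniteDimensional ℂ W] (φ : V →ₗ[ℂ] W) (h : FiniteDimensional ℂ φ.ker) :
    FiniteDimensional ℂ V :=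
  have : Module.Finite ℂ (V ⧸ φ.ker) := Module.Finite.equiv φ.quotKerEquivRange.symm
  Module.Finite.of_submodule_quotient φ.ker

/-- Adding a point at which a pole of the new order occurs raises the dimension by one. -/
theorem finrank_rrSpace_succ (z₀ : ℂ) {d : ℕ}
    (hfd : FiniteDimensional ℂ (rrSpace L S (Δ - Finsupp.single (proj L z₀) 1)))
    (hd : Module.finrank ℂ (rrSpace L S (Δ - Finsupp.single (proj L z₀) 1)) = d)
    (hex : ∃ f ∈ rrSpace L S Δ, f ∉ rrSpace L S (Δ - Finsupp.single (proj L z₀) 1)) :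
    FiniteDimensional ℂ (rrSpace L S Δ) ∧ Module.finrank ℂ (rrSpace L S Δ) = d + 1 := by
  have hle : rrSpace L S (Δ - Finsupp.single (proj L z₀) 1) ≤ rrSpace L S Δ :=
    rrSpace_mono (sub_le_self _ (Finsupp.single_nonneg.2 zero_le_one))
  have hker : (leadCoeffMap S Δ z₀).ker =
      (rrSpace L S (Δ - Finsupp.single (proj L z₀) 1)).comap (rrSpace L S Δ).subtype := by
    ext f
    exact leadCoeff_eq_zero_iff_mem f.2 z₀
  let e := Submodule.comapSubtypeEquivOfLe hle
  have hfin : FiniteDimensional ℂ (leadCoeffMap S Δ z₀).ker := by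
    rw [hker]
    exact Module.Finite.equiv e.symm
  have hfd' := finite_of_finite_ker _ hfin
  refine ⟨hfd', ?_⟩
  obtain ⟨f, hf, hf'⟩ := hex
  -- The smaller space is the kernel of a linear form, and the function `f` shows that this form is
  -- nonzero, hence onto `ℂ`.
  have hsurj : Function.Surjective (leadCoeffMap S Δ z₀) := by
    refine LinearMap.surjective fun h => hf' ?_
    exact (leadCoeff_eq_zero_iff_mem hf z₀).1 (LinearMap.congr_fun h ⟨f, hf⟩)
  rw [← LinearMap.finrank_range_add_finrank_ker (leadCoeffMap S Δ z₀),
    LinearMap.range_eq_top.2 hsurj, finrank_top, Module.finrank_self, hker, e.finrank_eq, hd,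
    add_comm]

theorem exists_pos_of_degree_pos {Δ : Curve L →₀ ℤ} (h : 0 < Δ.degree) : ∃ p, 0 < Δ p := by
  by_contra! hn
  exact absurd (Finset.sum_nonpos fun p _ => hn p) (not_le.2 h)

/-- A lone simple pole is impossible, so only constants remain. Their representative `e` equals `1`
off `S` and `0` on `S`. -/
theorem rrSpace_one_pole (hS : S.Finite) (z₀ : ℂ) :
    FiniteDimensional ℂ (rrSpace L S (Finsupp.single (proj L z₀) 1)) ∧
      Module.finrank ℂ (rrSpace L S (Finsupp.single (proj L z₀) 1)) = 1 := by
  classical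
  obtain ⟨e, he, he1⟩ := exists_mem_rrSpace (Δ := Finsupp.single (proj L z₀) 1) (F := fun _ => 1) hS
    (Meromorphic.const 1) (fun _ _ _ => rfl) (fun _ _ => analyticAt_const) (fun z => by
      refine le_trans ?_ analyticAt_const.meromorphicOrderAt_nonneg
      rw [Finsupp.single_apply]
      split_ifs <;> decide)
  have hval : ∀ f ∈ rrSpace L S (Finsupp.single (proj L z₀) 1), ∀ c,
      (∀ z, (fun w => f (proj L w)) =ᶠ[𝓝[≠] z] fun _ => c) → ∀ p ∉ S, f p = c := by
    intro f hf c hc p hp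
    obtain ⟨z, rfl⟩ := proj_surjective p
    exact tendsto_nhds_unique
      ((hf.2.1 z hp).continuousAt.tendsto.mono_left nhdsWithin_le_nhds)
      (tendsto_const_nhds.congr' (hc z).symm)
  have hspan : rrSpace L S (Finsupp.single (proj L z₀) 1) = Submodule.span ℂ {e} := by
    refine le_antisymm (fun f hf => ?_) ((Submodule.span_singleton_le_iff_mem _ _).2 he)
    have hper : ∀ l ∈ L.lattice, ∀ z, (fun w => f (proj L w)) (z + l) = (fun w => f (proj L w)) z :=
      fun l hl z => by simp only [proj_add_lattice hl]
    have ho : ∀ z, z - z₀ ∉ L.lattice → 0 ≤ meromorphicOrderAt (fun w => f (proj L w)) z :=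
      fun z hz => by
        have h := (hf.2.2 z).2
        rw [Finsupp.single_apply, if_neg] at h
        · simpa using h
        · rwa [eq_comm, proj_eq_proj_iff]
    have h0 := order_nonneg_of_simple_pole (fun z => (hf.2.2 z).1) hper ho
      (by simpa using (hf.2.2 z₀).2)
    obtain ⟨c, hc⟩ := exists_const_of_order_nonneg (fun z => (hf.2.2 z).1) hper (fun z => by
      by_cases hz : z - z₀ ∈ L.lattice
      · rwa [order_eq_of_proj_eq f (proj_eq_proj_iff.2 hz)]
      · exact ho z hz)
    rw [Submodule.mem_span_singleton]
    refine ⟨c, funext fun p => ?_⟩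
    by_cases hp : p ∈ S
    · simp [he.1 p hp, hf.1 p hp]
    · simp [hval f hf c hc p hp, hval e he 1 he1 p hp]
  have hne : e ≠ 0 := by
    rintro rfl
    obtain ⟨w, hw⟩ := (he1 0).exists
    simp at hw
  rw [hspan]
  exact ⟨inferInstance, finrank_span_singleton hne⟩

/-- For an effective divisor of degree at least two, all pole orders allowed at a point occur. -/
theorem exists_exact_order (h0 : 0 ≤ Δ) (hsupp : ∀ p, Δ p ≠ 0 → p ∈ S) (a : ℂ)
    (ha : 0 < Δ (proj L a)) (hdeg : 0 < (Δ - Finsupp.single (proj L a) 1).degree) :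
    ∃ F : ℂ → ℂ, Meromorphic F ∧ (∀ l ∈ L.lattice, ∀ z, F (z + l) = F z) ∧
      (∀ z, proj L z ∉ S → AnalyticAt ℂ F z) ∧
      (∀ z, ((-(Δ (proj L z)) : ℤ) : WithTop ℤ) ≤ meromorphicOrderAt F z) ∧
      meromorphicOrderAt F a = ((-(Δ (proj L a)) : ℤ) : WithTop ℤ) := by
  have hnotMem : ∀ b, 0 < Δ (proj L b) → ∀ z, proj L z ∉ S → z - b ∉ L.lattice :=
    fun b hb z hz h => hz (by rw [proj_eq_proj_iff.2 h]; exact hsupp _ hb.ne')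
  have hneg : ∀ z, ((-(Δ (proj L z)) : ℤ) : WithTop ℤ) ≤ 0 := fun z => by
    have := h0 (proj L z)
    simp only [Finsupp.coe_zero, Pi.zero_apply] at this
    norm_cast
    omega
  obtain ⟨p, hp⟩ := exists_pos_of_degree_pos hdeg
  obtain ⟨b, rfl⟩ := proj_surjective p
  by_cases h2 : 2 ≤ Δ (proj L a)
  · obtain ⟨m, hm⟩ := Int.eq_ofNat_of_zero_le ha.le
    obtain ⟨f, f1, f2, f3, f4⟩ := exists_pole_of_order L (m := m) (by omega)
    have ho : ∀ z, meromorphicOrderAt (fun z => f (z - a)) z = meromorphicOrderAt f (z - a) :=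
      fun z => meromorphicOrderAt_comp_sub_const_eq_meromorphicOrderAt (f := f)
    have hin : ∀ z, z - a ∈ L.lattice →
        meromorphicOrderAt (fun z => f (z - a)) z = ((-(Δ (proj L a)) : ℤ) : WithTop ℤ) :=
      fun z hz => by rw [ho, f4 _ hz, hm]
    have han : ∀ z, z - a ∉ L.lattice → AnalyticAt ℂ (fun z => f (z - a)) z := fun z hz =>
      (f3 _ hz).fun_comp (f := fun z => z - a) (by fun_prop)
    refine ⟨fun z => f (z - a), fun z => (f1 (z - a)).comp_analyticAt (g := fun z => z - a)
      (by fun_prop), fun l hl z => ?_, fun z hz => han z (hnotMem a ha z hz), fun z => ?_,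
      hin a (by simp)⟩
    · simp only [add_sub_right_comm z l a, f2 l hl]
    · by_cases hz : z - a ∈ L.lattice
      · rw [hin z hz, proj_eq_proj_iff.2 hz]
      · exact (hneg z).trans (han z hz).meromorphicOrderAt_nonneg
  -- No function has a single simple pole, so a second pole is needed: once the only copy of `a` is
  -- removed, the positive remaining degree supplies `b ≠ a`.
  · have h1 : Δ (proj L a) = 1 := by omega
    have hab : proj L a ≠ proj L b := by
      intro h
      rw [← h] at hp
      simp [h1] at hp
    have hb : 0 < Δ (proj L b) := by
      simpa [Finsupp.single_apply, hab] using hp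
    have hnot : ∀ z, z - a ∈ L.lattice → z - b ∉ L.lattice := fun z hz hz' =>
      hab ((proj_eq_proj_iff.2 hz).symm.trans (proj_eq_proj_iff.2 hz'))
    refine ⟨zetaDiff L a b, meromorphic_zetaDiff a b, fun l hl z => zetaDiff_add_lattice a b hl z,
      fun z hz => analyticAt_zetaDiff (hnotMem a ha z hz) (hnotMem b hb z hz), fun z => ?_, ?_⟩
    · by_cases hza : z - a ∈ L.lattice
      · rw [meromorphicOrderAt_zetaDiff_left hza (hnot z hza), proj_eq_proj_iff.2 hza, h1]
      · by_cases hzb : z - b ∈ L.lattice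
        · rw [meromorphicOrderAt_zetaDiff_right hza hzb, proj_eq_proj_iff.2 hzb]
          norm_cast
          omega
        · exact (hneg z).trans (analyticAt_zetaDiff hza hzb).meromorphicOrderAt_nonneg
    · rw [meromorphicOrderAt_zetaDiff_left (by simp) (hnot a (by simp)), h1]

/-- The Riemann-Roch theorem for effective divisors of positive degree on an elliptic curve. -/
theorem finrank_rrSpace (hS : S.Finite) (k : ℕ) : ∀ Δ : Curve L →₀ ℤ, 0 ≤ Δ →
    (∀ p, Δ p ≠ 0 → p ∈ S) → Δ.degree = k + 1 →
    FiniteDimensional ℂ (rrSpace L S Δ) ∧ Module.finrank ℂ (rrSpace L S Δ) = k + 1 := by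
  classical
  induction k with
  | zero =>
    intro Δ h0 hsupp hdeg
    obtain ⟨p, hp⟩ := exists_pos_of_degree_pos (Δ := Δ) (by rw [hdeg]; norm_num)
    obtain ⟨a, rfl⟩ := proj_surjective p
    -- An effective divisor of degree one is a point: subtracting `a` leaves an effective divisor of
    -- degree zero.
    have hΔ : Δ = Finsupp.single (proj L a) 1 := by
      have hle : 0 ≤ Δ - Finsupp.single (proj L a) 1 := by
        intro q
        have := h0 q
        simp only [Finsupp.coe_zero, Pi.zero_apply, Finsupp.sub_apply, Finsupp.single_apply] at *
        split_ifs with h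
        · subst h; omega
        · omega
      have hd : (Δ - Finsupp.single (proj L a) 1).degree = 0 := by
        rw [map_sub, hdeg, Finsupp.degree_single]
        norm_num
      have hz := (Finset.sum_eq_zero_iff_of_nonneg fun q _ => hle q).1 hd
      rw [← sub_eq_zero]
      ext q
      by_contra hq
      exact hq (hz q (Finsupp.mem_support_iff.2 hq))
    have := rrSpace_one_pole hS a
    rwa [← hΔ] at this
  | succ k ih =>
    intro Δ h0 hsupp hdeg
    obtain ⟨p, hp⟩ := exists_pos_of_degree_pos (Δ := Δ) (by rw [hdeg]; positivity)
    obtain ⟨a, rfl⟩ := proj_surjective p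
    have hle : 0 ≤ Δ - Finsupp.single (proj L a) 1 := by
      intro q
      have := h0 q
      simp only [Finsupp.coe_zero, Pi.zero_apply, Finsupp.sub_apply, Finsupp.single_apply] at *
      split_ifs with h
      · subst h; omega
      · omega
    have hd : (Δ - Finsupp.single (proj L a) 1).degree = (k : ℤ) + 1 := by
      rw [map_sub, hdeg, Finsupp.degree_single]
      push_cast
      ring
    have hsupp' : ∀ q, (Δ - Finsupp.single (proj L a) 1 : Curve L →₀ ℤ) q ≠ 0 → q ∈ S := by
      intro q hq
      by_cases h : proj L a = q
      · exact h ▸ hsupp _ hp.ne'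
      · exact hsupp q (by simpa [Finsupp.single_apply, h] using hq)
    obtain ⟨hfd, hfr⟩ := ih _ hle hsupp' hd
    refine finrank_rrSpace_succ a hfd hfr ?_
    obtain ⟨F, F1, F2, F3, F4, F5⟩ := exists_exact_order h0 hsupp a hp (by rw [hd]; positivity)
    obtain ⟨f, hf, hfF⟩ := exists_mem_rrSpace hS F1 F2 F3 F4
    refine ⟨f, hf, fun hf' => ?_⟩
    have := (hf'.2.2 a).2
    rw [meromorphicOrderAt_congr (hfF a), F5] at this
    simp only [Finsupp.sub_apply, Finsupp.single_eq_same] at this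
    norm_cast at this
    omega

end RiemannRoch

/-! ### Residues of scalar functions and their free prescription. -/

section Residues

variable {L : PeriodPair}

/-- The residue at the point `p` of a scalar function with at most a simple pole at `p` is `r`. -/
def HasScalarRes (f : Curve L → ℂ) (p : Curve L) (r : ℂ) : Prop :=
  ∀ z : ℂ, proj L z = p → Tendsto (fun w => (w - z) * f (proj L w)) (𝓝[≠] z) (𝓝 r)

theorem hasRes_iff {n : ℕ} {M : Curve L → Mat n} {p : Curve L} {R : Mat n} :
    HasRes M p R ↔ ∀ j k, HasScalarRes (fun p => M p j k) p (R j k) := by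
  constructor
  · intro h j k z hz
    exact ((continuous_apply_apply j k).tendsto R).comp (h z hz)
  · intro h z hz
    exact tendsto_pi_nhds.2 fun j => tendsto_pi_nhds.2 fun k => h j k z hz

theorem HasScalarRes.unique {f : Curve L → ℂ} {p : Curve L} {r s : ℂ} (h : HasScalarRes f p r)
    (h' : HasScalarRes f p s) : r = s := by
  obtain ⟨z, hz⟩ := proj_surjective p
  exact tendsto_nhds_unique (h z hz) (h' z hz)

theorem HasScalarRes.neg {f : Curve L → ℂ} {p : Curve L} {r : ℂ} (h : HasScalarRes f p r) :
    HasScalarRes (fun p => -f p) p (-r) := fun z hz => by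
  simpa only [mul_neg] using (h z hz).neg

/-- Translation by a lattice vector carries the limit to any other representative. -/
theorem hasScalarRes_of_tendsto {f : Curve L → ℂ} {z₀ r : ℂ}
    (h : Tendsto (fun w => (w - z₀) * f (proj L w)) (𝓝[≠] z₀) (𝓝 r)) :
    HasScalarRes f (proj L z₀) r := by
  intro z hz
  rw [proj_eq_proj_iff] at hz
  have h1 : Tendsto (fun w => w - (z - z₀)) (𝓝[≠] z) (𝓝[≠] z₀) := by
    refine tendsto_nhdsWithin_of_tendsto_nhds_of_eventually_within _ ?_ ?_
    · refine Tendsto.mono_left ?_ nhdsWithin_le_nhds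
      have : Continuous fun w : ℂ => w - (z - z₀) := by fun_prop
      simpa using this.tendsto z
    · filter_upwards [self_mem_nhdsWithin] with w hw hw'
      refine hw ?_
      simp only [Set.mem_singleton_iff] at *
      linear_combination hw'
  refine (h.comp h1).congr fun w => ?_
  have h2 : proj L (w - (z - z₀)) = proj L w := by
    rw [sub_eq_add_neg]
    exact proj_add_lattice (neg_mem hz) w
  simp only [Function.comp_apply, h2]
  ring

variable {S : Set (Curve L)} {Δ : Curve L →₀ ℤ}

theorem hasScalarRes_leadCoeff {f : Curve L → ℂ} (hf : f ∈ rrSpace L S Δ) {z₀ : ℂ}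
    (h : Δ (proj L z₀) = 1) : HasScalarRes f (proj L z₀) (leadCoeff z₀ (Δ (proj L z₀)) f) := by
  refine hasScalarRes_of_tendsto ?_
  have := tendsto_leadCoeff_of_mem hf z₀
  rw [h] at this ⊢
  simpa only [_root_.zpow_one] using this

theorem hasScalarRes_zero {f : Curve L → ℂ} (hf : f ∈ rrSpace L S Δ) {p : Curve L}
    (h : Δ p = 0) : HasScalarRes f p 0 := by
  rintro z rfl
  have h1 := tendsto_leadCoeff_of_mem hf z
  rw [h] at h1
  simp only [_root_.zpow_zero, one_mul] at h1
  have h2 : Tendsto (fun w : ℂ => w - z) (𝓝[≠] z) (𝓝 0) := by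
    have : Continuous fun w : ℂ => w - z := by fun_prop
    simpa using (this.tendsto z).mono_left nhdsWithin_le_nhds
  simpa using h2.mul h1

variable {n : ℕ} {D : Curve L →₀ ℤ} {q : Fin n → Curve L}

/-- The divisor `D + ∑ qᵢ`. -/
abbrev withPoles {n : ℕ} (D : Curve L →₀ ℤ) (q : Fin n → Curve L) : Curve L →₀ ℤ :=
  D + ∑ i, Finsupp.single (q i) 1

theorem withPoles_apply_of_ne {p : Curve L} (h : ∀ i, q i ≠ p) :
    (withPoles D q) p = D p := by
  classical
  simp [h]

theorem withPoles_apply (hq : Function.Injective q) (i : Fin n) :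
    (withPoles D q) (q i) = D (q i) + 1 := by
  classical
  simp [Finsupp.single_apply, hq.eq_iff]

theorem mem_rrSpace_of_hasScalarRes_zero (hq : Function.Injective q) (hDq : ∀ i, D (q i) = 0)
    {f : Curve L → ℂ} (hf : f ∈ rrSpace L S (withPoles D q))
    (h : ∀ i, HasScalarRes f (q i) 0) : f ∈ rrSpace L S D := by
  refine ⟨hf.1, hf.2.1, fun z => ⟨(hf.2.2 z).1, ?_⟩⟩
  by_cases hz : ∃ i, q i = proj L z
  · obtain ⟨i, hi⟩ := hz
    have h1 : (withPoles D q) (proj L z) = 1 := by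
      rw [← hi, withPoles_apply hq, hDq, zero_add]
    have h2 := (hasScalarRes_leadCoeff hf h1).unique (hi ▸ h i)
    rw [leadCoeff_eq_zero_iff (hf.2.2 z).1 (hf.2.2 z).2, h1] at h2
    rw [← hi, hDq]
    exact h2
  · have := (hf.2.2 z).2
    rwa [withPoles_apply_of_ne (fun i hi => hz ⟨i, hi⟩)] at this

/-- Functions with simple poles at given points and with prescribed residues, linearly in the
residues. -/
theorem exists_residue_section (hS : S.Finite) (hq : Function.Injective q)
    (hDq : ∀ i, D (q i) = 0) (hqS : ∀ i, q i ∈ S) (h0 : 0 ≤ D) (hsupp : ∀ p, D p ≠ 0 → p ∈ S)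
    {k : ℕ} (hdeg : D.degree = k + 1) :
    ∃ s : (Fin n → ℂ) →ₗ[ℂ] rrSpace L S (withPoles D q),
      ∀ c i, HasScalarRes (s c).1 (q i) (c i) := by
  classical
  have hle : D ≤ withPoles D q :=
    le_add_of_nonneg_right (Finset.sum_nonneg fun i _ => Finsupp.single_nonneg.2 zero_le_one)
  obtain ⟨fD, dD⟩ := finrank_rrSpace hS k D h0 hsupp hdeg
  obtain ⟨fE, dE⟩ := finrank_rrSpace hS (k + n) (withPoles D q) (h0.trans hle)
    (fun p hp => by
      by_cases h : ∃ i, q i = p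
      · obtain ⟨i, rfl⟩ := h
        exact hqS i
      · rw [withPoles_apply_of_ne (fun i hi => h ⟨i, hi⟩)] at hp
        exact hsupp p hp)
    (by
      rw [map_add, map_sum, hdeg]
      simp only [Finsupp.degree_single, Finset.sum_const, Finset.card_univ, Fintype.card_fin,
        nsmul_eq_mul, mul_one]
      push_cast
      ring)
  choose z hz using fun i => proj_surjective (q i)
  have h1 : ∀ i, (withPoles D q) (proj L (z i)) = 1 := fun i => by
    rw [hz, withPoles_apply hq, hDq, zero_add]
  let φ : rrSpace L S (withPoles D q) →ₗ[ℂ] (Fin n → ℂ) :=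
    LinearMap.pi fun i => leadCoeffMap S _ (z i)
  have hφ : ∀ f i, HasScalarRes f.1 (q i) (φ f i) := fun f i => by
    have : HasScalarRes f.1 (proj L (z i)) (φ f i) := hasScalarRes_leadCoeff f.2 (h1 i)
    rwa [hz] at this
  have hker : φ.ker = (rrSpace L S D).comap (rrSpace L S _).subtype := by
    ext f
    rw [LinearMap.mem_ker, Submodule.mem_comap]
    constructor
    · intro h
      refine mem_rrSpace_of_hasScalarRes_zero hq hDq f.2 fun i => ?_
      have := hφ f i
      rwa [h] at this
    · intro h
      exact funext fun i => (hφ f i).unique (hasScalarRes_zero h (hDq i))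
  -- The residue map goes from dimension `k + n + 1` to dimension `n`, with kernel `H⁰(O(D))` of
  -- dimension `k + 1`; its rank is therefore `n`.
  have hsurj : Function.Surjective φ := by
    have hr := LinearMap.finrank_range_add_finrank_ker φ
    rw [hker, (Submodule.comapSubtypeEquivOfLe (rrSpace_mono hle)).finrank_eq, dD, dE] at hr
    rw [← LinearMap.range_eq_top]
    refine Submodule.eq_top_of_finrank_eq ?_
    rw [Module.finrank_fin_fun]
    omega
  -- Linearity of the section will preserve the skew-symmetry of a matrix of prescribed residues.
  obtain ⟨s, hs⟩ := φ.exists_rightInverse_of_surjective (LinearMap.range_eq_top.2 hsurj)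
  refine ⟨s, fun c i => ?_⟩
  have := hφ (s c) i
  rwa [show φ (s c) = c from LinearMap.congr_fun hs c] at this

end Residues

/-! ### The dimension of `so(2n)` and the algebra of the residue matrices. -/

section Algebra

variable {n : ℕ}

/-- Swapping coordinates matches the pairs above and below the diagonal. The additive form avoids
subtraction and division in `ℕ`. -/
theorem two_mul_card_lt_add (n : ℕ) :
    2 * Fintype.card {p : Fin n × Fin n // p.1 < p.2} + n = n * n := by
  rw [Fintype.card_subtype]
  have h1 : (Finset.univ.filter fun p : Fin n × Fin n => p.2 < p.1).card =
      (Finset.univ.filter fun p : Fin n × Fin n => p.1 < p.2).card :=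
    Finset.card_bij (fun p _ => p.swap) (by simp) (by simp) (fun p hp => ⟨p.swap, by simpa using hp⟩)
  have h2 : (Finset.univ.filter fun p : Fin n × Fin n => p.1 = p.2).card = n := by
    trans (Finset.univ : Finset (Fin n)).card
    · exact Finset.card_bij (fun p _ => p.1) (by simp)
        (by rintro ⟨a, b⟩ h ⟨c, d⟩ h' e; simp_all) (fun i _ => ⟨(i, i), by simp⟩)
    · rw [Finset.card_univ, Fintype.card_fin]
  have h3 := Finset.card_filter_add_card_filter_not (s := (Finset.univ : Finset (Fin n × Fin n)))
    (fun p => p.1 < p.2)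
  have h4 := Finset.card_filter_add_card_filter_not
    (s := Finset.univ.filter fun p : Fin n × Fin n => ¬ p.1 < p.2) (fun p => p.1 = p.2)
  have h5 : ((Finset.univ.filter fun p : Fin n × Fin n => ¬ p.1 < p.2).filter
      fun p => p.1 = p.2) = Finset.univ.filter fun p : Fin n × Fin n => p.1 = p.2 := by
    ext p
    simp only [Finset.mem_filter, Finset.mem_univ, true_and]
    exact ⟨fun h => h.2, fun h => ⟨by omega, h⟩⟩
  have h6 : ((Finset.univ.filter fun p : Fin n × Fin n => ¬ p.1 < p.2).filter
      fun p => ¬ p.1 = p.2) = Finset.univ.filter fun p : Fin n × Fin n => p.2 < p.1 := by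
    ext p
    simp only [Finset.mem_filter, Finset.mem_univ, true_and]
    omega
  rw [h5, h6, h2, h1] at h4
  rw [Finset.card_univ, Fintype.card_prod, Fintype.card_fin] at h3
  omega

/-- The skew-symmetric matrix with given entries above the diagonal. -/
def skewOf (c : {p : Fin n × Fin n // p.1 < p.2} → ℂ) : Matrix (Fin n) (Fin n) ℂ :=
  of fun j k => if h : j < k then c ⟨(j, k), h⟩ else if h : k < j then -c ⟨(k, j), h⟩ else 0

theorem skewOf_transpose (c : {p : Fin n × Fin n // p.1 < p.2} → ℂ) : (skewOf c)ᵀ = -skewOf c := by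
  ext j k
  rcases lt_trichotomy j k with h | rfl | h
  · simp [skewOf, h, not_lt.2 h.le]
  · simp [skewOf]
  · simp [skewOf, h, not_lt.2 h.le]

theorem eq_zero_of_skew {B : Matrix (Fin n) (Fin n) ℂ} (hB : Bᵀ = -B)
    (h : ∀ j k, j < k → B j k = 0) : B = 0 := by
  have hs : ∀ j k, B k j = -B j k := fun j k => congr_fun (congr_fun hB j) k
  ext j k
  rcases lt_trichotomy j k with hjk | rfl | hjk
  · exact h j k hjk
  · have := hs j j
    simp only [Matrix.zero_apply]
    linear_combination this / 2
  · rw [hs, h k j hjk]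
    simp

/-- The independent entries of a matrix in `so(2n)`. -/
def soCoords (n : ℕ) : so2n n →ₗ[ℂ] (Fin n × Fin n → ℂ) ×
    ({p : Fin n × Fin n // p.1 < p.2} → ℂ) × ({p : Fin n × Fin n // p.1 < p.2} → ℂ) where
  toFun X := (fun p => X.1 (.inl p.1) (.inl p.2), fun p => X.1 (.inl p.1.1) (.inr p.1.2),
    fun p => X.1 (.inr p.1.1) (.inl p.1.2))
  map_add' _ _ := rfl
  map_smul' _ _ := rfl

theorem soCoords_bijective (n : ℕ) : Function.Bijective (soCoords n) := by
  constructor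
  · rw [← LinearMap.ker_eq_bot, LinearMap.ker_eq_bot']
    rintro ⟨X, hX⟩ h
    obtain ⟨A, B, C, hB, hC, rfl⟩ := (mem_so2n_iff X).1 hX
    obtain ⟨h1, h2⟩ := Prod.ext_iff.1 h
    obtain ⟨h2, h3⟩ := Prod.ext_iff.1 h2
    have hA : A = 0 := by
      ext j k
      exact congr_fun h1 (j, k)
    have hB0 : B = 0 := eq_zero_of_skew hB fun j k hjk => congr_fun h2 ⟨(j, k), hjk⟩
    have hC0 : C = 0 := eq_zero_of_skew hC fun j k hjk => congr_fun h3 ⟨(j, k), hjk⟩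
    ext1
    simp [hA, hB0, hC0]
  · rintro ⟨a, b, c⟩
    refine ⟨⟨fromBlocks (of fun j k => a (j, k)) (skewOf b) (skewOf c) (-(of fun j k => a (j, k))ᵀ),
      (mem_so2n_iff _).2 ⟨_, _, _, skewOf_transpose b, skewOf_transpose c, rfl⟩⟩, ?_⟩
    refine Prod.ext rfl (Prod.ext (funext fun p => ?_) (funext fun p => ?_))
    · exact dif_pos p.2
    · exact dif_pos p.2

theorem finrank_so2n_add (n : ℕ) : Module.finrank ℂ (so2n n) + n = 2 * (n * n) := by
  rw [(LinearEquiv.ofBijective _ (soCoords_bijective n)).finrank_eq, Module.finrank_prod,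
    Module.finrank_prod, Module.finrank_fintype_fun_eq_card, Module.finrank_fintype_fun_eq_card,
    Fintype.card_prod, Fintype.card_fin]
  have := two_mul_card_lt_add n
  omega

/-- Right multiplication by `σ` swaps the block columns. The upper right block is `a ∧ c`; it
decides which parameters are compatible with the poles allowed for `B`. -/
theorem tyurinResidue_elim (a b c d : Fin n → ℂ) :
    tyurinResidue (Sum.elim a b) (Sum.elim c d) =
      fromBlocks (vecMulVec a d - vecMulVec c b) (vecMulVec a c - vecMulVec c a)
        (vecMulVec b d - vecMulVec d b) (vecMulVec b c - vecMulVec d a) := by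
  have h : ∀ a b c d : Fin n → ℂ, vecMulVec (Sum.elim a b) (Sum.elim c d) =
      fromBlocks (vecMulVec a c) (vecMulVec a d) (vecMulVec b c) (vecMulVec b d) := by
    intro a b c d
    ext (j | j) (k | k) <;> rfl
  rw [tyurinResidue, h, h, sig, LieAlgebra.Orthogonal.JD, sub_eq_add_neg, fromBlocks_neg,
    fromBlocks_add, fromBlocks_multiply]
  simp [sub_eq_add_neg]

/-- The source of the freedom `μ ↦ μ + c α`, used both to normalize `μ` and to match the motions. -/
theorem tyurinResidue_self (α : Fin n ⊕ Fin n → ℂ) : tyurinResidue α α = 0 := by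
  simp [tyurinResidue]

theorem tyurinResidue_add_smul_self (α μ : Fin n ⊕ Fin n → ℂ) (c : ℂ) :
    tyurinResidue α (μ + c • α) = tyurinResidue α μ := by
  rw [tyurinResidue_add, tyurinResidue_smul, tyurinResidue_self, smul_zero, add_zero]

theorem exists_eq_smul {a b : Fin n → ℂ} (ha : a ≠ 0) (h : ∀ j k, a j * b k - b j * a k = 0) :
    ∃ c : ℂ, b = c • a := by
  obtain ⟨j, hj⟩ := Function.ne_iff.1 ha
  simp only [Pi.zero_apply] at hj
  refine ⟨b j / a j, funext fun k => ?_⟩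
  simp only [Pi.smul_apply, smul_eq_mul]
  field_simp
  linear_combination h j k

end Algebra

/-! ### The residue map and the dimension of the space of admissible residues. -/

section Parameters

variable {L : PeriodPair} {n : ℕ}

theorem finrank_range_of_ker_eq_range {U V W : Type*} [AddCommGroup U] [Module ℂ U]
    [AddCommGroup V] [Module ℂ V] [AddCommGroup W] [Module ℂ W] [FiniteDimensional ℂ V]
    (g : U →ₗ[ℂ] V) (f : V →ₗ[ℂ] W) (hg : Function.Injective g) (h : f.ker = g.range) :
    Module.finrank ℂ f.range + Module.finrank ℂ U = Module.finrank ℂ V := by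
  rw [← LinearMap.finrank_range_add_finrank_ker f, h, LinearMap.finrank_range_of_inj hg]

/-- A linear form applied to a matrix of functions in a Riemann-Roch space. -/
theorem linearForm_mem_rrSpace {S : Set (Curve L)} {Δ : Curve L →₀ ℤ} (l : Mat n →ₗ[ℂ] ℂ)
    {M : Curve L → Mat n} (h : ∀ j k, (fun p => M p j k) ∈ rrSpace L S Δ) :
    (fun p => l (M p)) ∈ rrSpace L S Δ := by
  have e : (fun p => l (M p)) =
      ∑ j, ∑ k, l (Matrix.single j k 1) • fun p => M p j k := by
    ext p
    conv_lhs => rw [Matrix.matrix_eq_sum_single (M p)]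
    simp only [map_sum, Finset.sum_apply, Pi.smul_apply, smul_eq_mul]
    refine Finset.sum_congr rfl fun j _ => Finset.sum_congr rfl fun k _ => ?_
    rw [mul_comm, ← smul_eq_mul, ← map_smul, Matrix.smul_single, smul_eq_mul, mul_one]
  rw [e]
  exact Submodule.sum_mem _ fun j _ => Submodule.sum_mem _ fun k _ => Submodule.smul_mem _ _ (h j k)

/-- The residue at `p` of a matrix-valued function with at most a simple pole at `p`. -/
def resAt (M : Curve L → Mat n) (p : Curve L) : Mat n :=
  limUnder (𝓝[≠] (proj_surjective p).choose)
    fun w => (w - (proj_surjective p).choose) • M (proj L w)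

theorem HasRes.resAt_eq {M : Curve L → Mat n} {p : Curve L} {R : Mat n} (h : HasRes M p R) :
    resAt M p = R :=
  (h _ (proj_surjective p).choose_spec).limUnder_eq

namespace Data

variable (T : Data L n)

/-- The residues of the functions in `𝒩ᴰ` at the points `qᵢ` and `-qᵢ`. -/
def residues : T.ND →ₗ[ℂ] (Fin n → Mat n) × (Fin n → Mat n) where
  toFun M := (fun i => resAt M.1 (T.q i), fun i => resAt M.1 (-T.q i))
  map_add' M N := by
    -- `resAt` is additive only where the limits exist; membership in `𝒩ᴰ` guarantees this.
    obtain ⟨_, _, _, _, hM⟩ := M.2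
    obtain ⟨_, _, _, _, hN⟩ := N.2
    refine Prod.ext (funext fun i => ?_) (funext fun i => ?_)
    · exact ((hM.res_q i).add (hN.res_q i)).resAt_eq.trans
        (congr_arg₂ _ (hM.res_q i).resAt_eq.symm (hN.res_q i).resAt_eq.symm)
    · exact ((hM.res_neg_q i).add (hN.res_neg_q i)).resAt_eq.trans
        (congr_arg₂ _ (hM.res_neg_q i).resAt_eq.symm (hN.res_neg_q i).resAt_eq.symm)
  map_smul' c M := by
    obtain ⟨_, _, _, _, hM⟩ := M.2
    refine Prod.ext (funext fun i => ?_) (funext fun i => ?_)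
    · exact ((hM.res_q i).smul c).resAt_eq.trans (congr_arg _ (hM.res_q i).resAt_eq.symm)
    · exact ((hM.res_neg_q i).smul c).resAt_eq.trans (congr_arg _ (hM.res_neg_q i).resAt_eq.symm)

variable {T} in
theorem residues_eq {M : T.ND} {μ' μ'' μm : Fin n → Fin n → ℂ}
    (h : T.HasTyurinResidues M.1 μ' μ'' μm) :
    T.residues M = (fun i => tyurinResidue (Sum.elim (T.a' i) (T.a'' i)) (Sum.elim (μ' i) (μ'' i)),
      fun i => tyurinResidue (Sum.elim (T.am i) 0) (Sum.elim (μm i) 0)) :=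
  Prod.ext (funext fun i => (h.res_q i).resAt_eq) (funext fun i => (h.res_neg_q i).resAt_eq)

/-- The residues with parameters `μᵢ = (0, νᵢ)` and `μ₋ᵢ = (mᵢ, 0)`. -/
def paramResidues : (Fin n → Fin n → ℂ) × (Fin n → Fin n → ℂ) →ₗ[ℂ]
    (Fin n → Mat n) × (Fin n → Mat n) where
  toFun x := (fun i => tyurinResidue (Sum.elim (T.a' i) (T.a'' i)) (Sum.elim 0 (x.1 i)),
    fun i => tyurinResidue (Sum.elim (T.am i) 0) (Sum.elim (x.2 i) 0))
  map_add' x y := by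
    refine Prod.ext (funext fun i => ?_) (funext fun i => ?_)
    · simp only [Prod.fst_add, Pi.add_apply, ← tyurinResidue_add, ← elim_add, add_zero]
    · simp only [Prod.snd_add, Pi.add_apply, ← tyurinResidue_add, ← elim_add, add_zero]
  map_smul' c x := by
    refine Prod.ext (funext fun i => ?_) (funext fun i => ?_)
    · simp only [Prod.smul_fst, Pi.smul_apply, ← tyurinResidue_smul, ← elim_smul, smul_zero,
        RingHom.id_apply]
    · simp only [Prod.smul_snd, Pi.smul_apply, ← tyurinResidue_smul, ← elim_smul, smul_zero,
        RingHom.id_apply]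

/-- The parameters with zero residues. -/
def trivialParams : (Fin n → ℂ) →ₗ[ℂ] (Fin n → Fin n → ℂ) × (Fin n → Fin n → ℂ) where
  toFun c := (0, fun i => c i • T.am i)
  map_add' c d := Prod.ext (by simp) (funext fun i => add_smul (c i) (d i) (T.am i))
  map_smul' r c := Prod.ext (by simp) (funext fun i => by simp [mul_smul])

variable {T}

theorem paramResidues_trivialParams (c : Fin n → ℂ) : T.paramResidues (T.trivialParams c) = 0 := by
  refine Prod.ext (funext fun i => ?_) (funext fun i => ?_)
  · change tyurinResidue (Sum.elim (T.a' i) (T.a'' i)) (Sum.elim 0 0) = 0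
    rw [Sum.elim_zero_zero, tyurinResidue_zero]
  · change tyurinResidue (Sum.elim (T.am i) 0) (Sum.elim (c i • T.am i) 0) = 0
    have h := elim_smul (c i) (T.am i) 0
    rw [smul_zero] at h
    rw [h, tyurinResidue_smul, tyurinResidue_self, smul_zero]

/-- Of the `2n²` parameters, `νᵢ` is recovered from the block `αᵢ' νᵢᵗ` because `αᵢ' ≠ 0`, while
`mᵢ` enters only through `α₋ᵢ' ∧ mᵢ` and is lost exactly up to multiples of `α₋ᵢ'`. The kernel has
dimension `n`. -/
theorem finrank_range_paramResidues (hT : T.Generic) :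
    Module.finrank ℂ T.paramResidues.range + n = 2 * (n * n) := by
  have hinj : Function.Injective T.trivialParams := by
    intro c d h
    have h2 := (Prod.ext_iff.1 h).2
    exact funext fun i => smul_left_injective ℂ (hT.am_ne_zero i) (congr_fun h2 i)
  have hker : T.paramResidues.ker = T.trivialParams.range := by
    ext ⟨ν, m⟩
    rw [LinearMap.mem_ker, LinearMap.mem_range]
    constructor
    · intro h
      obtain ⟨h1, h2⟩ := Prod.ext_iff.1 h
      have h1 : ∀ i, tyurinResidue (Sum.elim (T.a' i) (T.a'' i)) (Sum.elim 0 (ν i)) = 0 :=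
        fun i => congr_fun h1 i
      have h2 : ∀ i, tyurinResidue (Sum.elim (T.am i) 0) (Sum.elim (m i) 0) = 0 :=
        fun i => congr_fun h2 i
      have hν : ν = 0 := by
        ext i k
        obtain ⟨j, hj⟩ := Function.ne_iff.1 (hT.a'_ne_zero i)
        have := congr_fun (congr_fun (h1 i) (.inl j)) (.inl k)
        rw [tyurinResidue_elim] at this
        simp only [fromBlocks_apply₁₁, Matrix.sub_apply, vecMulVec_apply, Pi.zero_apply, zero_mul,
          sub_zero, Matrix.zero_apply] at this
        exact (mul_eq_zero.1 this).resolve_left hj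
      have hm : ∀ i, ∃ c : ℂ, m i = c • T.am i := fun i => by
        refine exists_eq_smul (hT.am_ne_zero i) fun j k => ?_
        have := congr_fun (congr_fun (h2 i) (.inl j)) (.inr k)
        rw [tyurinResidue_elim] at this
        exact this
      choose c hc using hm
      exact ⟨c, Prod.ext hν.symm (funext fun i => (hc i).symm)⟩
    · rintro ⟨c, hc⟩
      rw [← hc, paramResidues_trivialParams]
  have := finrank_range_of_ker_eq_range _ _ hinj hker
  simp only [Module.finrank_prod, Module.finrank_pi_fintype,
    Finset.sum_const, Finset.card_univ, Fintype.card_fin, smul_eq_mul,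
    Module.finrank_self, mul_one] at this
  omega

theorem intD_apply (p : Curve L) : T.intD p = T.D p := by
  rw [intD, Finsupp.mapRange_apply]

theorem intD_nonneg : 0 ≤ T.intD := fun p => by
  rw [intD_apply]
  exact Int.natCast_nonneg _

theorem degree_intD : T.intD.degree = T.deg := by
  have : T.intD.degree = T.intD.sum fun _ m => m := rfl
  rw [this, intD, Finsupp.sum_mapRange_index (fun _ => rfl), deg, Finsupp.sum, Finsupp.sum,
    Nat.cast_sum]

theorem exists_deg_eq (hD : T.D ≠ 0) : ∃ k, T.deg = k + 1 := by
  refine Nat.exists_eq_succ_of_ne_zero fun h => hD ?_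
  exact (Finsupp.degree_eq_zero_iff T.D).1 h

theorem finite_marked : T.marked.Finite :=
  (T.D.support.finite_toSet.union (Set.finite_range _)).union (Set.finite_range _)

theorem mem_marked_of_intD_ne_zero {p : Curve L} (h : T.intD p ≠ 0) : p ∈ T.marked := by
  rw [intD_apply] at h
  exact Or.inl (Or.inl (Finsupp.mem_support_iff.2 (by exact_mod_cast h)))


end Data

end Parameters

/-! ### Kernel and image of the residue map, and the dimension count. -/

section Dimension

variable {L : PeriodPair} {n : ℕ}

namespace Data

variable {T : Data L n}

theorem Generic.q_injective (hT : T.Generic) : Function.Injective T.q := fun _ _ h =>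
  Sum.inl_injective (hT.injective h)

theorem Generic.neg_q_injective (hT : T.Generic) : Function.Injective fun i => -T.q i := fun _ _ h =>
  Sum.inr_injective (hT.injective h)

theorem Generic.neg_q_ne_q (hT : T.Generic) (i j : Fin n) : -T.q i ≠ T.q j := fun h =>
  Sum.inr_ne_inl (hT.injective h)

theorem Generic.intD_q (hT : T.Generic) (i : Fin n) : T.intD (T.q i) = 0 := by
  rw [intD_apply, Finsupp.notMem_support_iff.1 (hT.q_notMem i), Nat.cast_zero]

theorem Generic.intD_neg_q (hT : T.Generic) (i : Fin n) : T.intD (-T.q i) = 0 := by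
  rw [intD_apply, Finsupp.notMem_support_iff.1 (hT.neg_q_notMem i), Nat.cast_zero]

theorem Generic.divPlus_neg_q (hT : T.Generic) (i : Fin n) : T.divPlus (-T.q i) = 0 :=
  (withPoles_apply_of_ne fun j => (hT.neg_q_ne_q i j).symm).trans (hT.intD_neg_q i)

theorem Generic.divMinus_q (hT : T.Generic) (i : Fin n) : T.divMinus (T.q i) = 0 :=
  (withPoles_apply_of_ne (q := fun i => -T.q i) fun j => hT.neg_q_ne_q j i).trans (hT.intD_q i)

theorem q_mem_marked (i : Fin n) : T.q i ∈ T.marked := Or.inl (Or.inr ⟨i, rfl⟩)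

theorem neg_q_mem_marked (i : Fin n) : -T.q i ∈ T.marked := Or.inr ⟨i, rfl⟩

theorem exists_section_plus (hD : T.D ≠ 0) (hT : T.Generic) :
    ∃ s : (Fin n → ℂ) →ₗ[ℂ] rrSpace L T.marked T.divPlus,
      ∀ c i, HasScalarRes (s c).1 (T.q i) (c i) := by
  obtain ⟨k, hk⟩ := exists_deg_eq hD
  exact exists_residue_section finite_marked hT.q_injective hT.intD_q q_mem_marked intD_nonneg
    (fun _ => mem_marked_of_intD_ne_zero) (k := k) (by rw [degree_intD, hk]; norm_cast)

theorem exists_section_minus (hD : T.D ≠ 0) (hT : T.Generic) :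
    ∃ s : (Fin n → ℂ) →ₗ[ℂ] rrSpace L T.marked T.divMinus,
      ∀ c i, HasScalarRes (s c).1 (-T.q i) (c i) := by
  obtain ⟨k, hk⟩ := exists_deg_eq hD
  exact exists_residue_section finite_marked hT.neg_q_injective hT.intD_neg_q neg_q_mem_marked
    intD_nonneg (fun _ => mem_marked_of_intD_ne_zero) (k := k)
    (by rw [degree_intD, hk]; norm_cast)

theorem finrank_rrSpace_intD (hD : T.D ≠ 0) :
    FiniteDimensional ℂ (rrSpace L T.marked T.intD) ∧
      Module.finrank ℂ (rrSpace L T.marked T.intD) = T.deg := by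
  obtain ⟨k, hk⟩ := exists_deg_eq hD
  rw [hk]
  exact finrank_rrSpace finite_marked k _ intD_nonneg (fun _ => mem_marked_of_intD_ne_zero)
    (by rw [degree_intD, hk]; norm_cast)

theorem HasBlocks.apply_inr_inr {M : Curve L → Mat n} (h : T.HasBlocks M) (p : Curve L) (j k : Fin n) :
    M p (.inr j) (.inr k) = -M p (.inl k) (.inl j) := by
  obtain ⟨A, B, C, -, -, e⟩ := (mem_so2n_iff _).1 (h.mem_so p)
  rw [e]
  rfl

/-- Regularity of `B` at `qᵢ` gives `αᵢ' ∧ μᵢ' = 0`, so `μᵢ' = cᵢ αᵢ'`, and subtracting `cᵢ αᵢ` from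
`μᵢ` brings it to the form `(0, νᵢ)`. -/
theorem residues_mem_range (hT : T.Generic) (M : T.ND) :
    T.residues M ∈ T.paramResidues.range := by
  obtain ⟨hb, μ', μ'', μm, hr⟩ := M.2
  have hμ : ∀ i, ∃ c : ℂ, μ' i = c • T.a' i := fun i => by
    refine exists_eq_smul (hT.a'_ne_zero i) fun j k => ?_
    have h1 := hasRes_iff.1 (hr.res_q i) (.inl j) (.inr k)
    rw [tyurinResidue_elim] at h1
    exact h1.unique (hasScalarRes_zero (hb.blockB j k) (hT.divMinus_q i))
  choose c hc using hμ
  refine ⟨(fun i => μ'' i - c i • T.a'' i, μm), ?_⟩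
  rw [residues_eq hr]
  refine Prod.ext (funext fun i => ?_) rfl
  change tyurinResidue _ (Sum.elim 0 (μ'' i - c i • T.a'' i)) = _
  rw [← tyurinResidue_add_smul_self _ _ (c i), ← elim_smul, ← elim_add, zero_add, sub_add_cancel,
    ← hc]

theorem exists_residues_eq (hD : T.D ≠ 0) (hT : T.Generic)
    (x : (Fin n → Fin n → ℂ) × (Fin n → Fin n → ℂ)) : ∃ M : T.ND, T.residues M = T.paramResidues x := by
  obtain ⟨ν, m⟩ := x
  obtain ⟨sp, hsp⟩ := exists_section_plus hD hT
  obtain ⟨sm, hsm⟩ := exists_section_minus hD hT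
  -- The residues of the entries of `A`, `B`, `C`, read off `tyurinResidue_elim` with `μᵢ' = 0`;
  -- those of `A` and `C` are at `qᵢ`, those of `B` at `-qᵢ`.
  let a : Fin n → Fin n → Fin n → ℂ := fun j k i => T.a' i j * ν i k
  let b : Fin n → Fin n → Fin n → ℂ := fun j k i => T.am i j * m i k - m i j * T.am i k
  let c : Fin n → Fin n → Fin n → ℂ := fun j k i => T.a'' i j * ν i k - ν i j * T.a'' i k
  have hb : ∀ j k, b k j = -b j k := fun j k => funext fun i => by simp only [b, Pi.neg_apply]; ring
  have hc : ∀ j k, c k j = -c j k := fun j k => funext fun i => by simp only [c, Pi.neg_apply]; ring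
  let M : Curve L → Mat n := fun p => fromBlocks (of fun j k => (sp (a j k)).1 p)
    (of fun j k => (sm (b j k)).1 p) (of fun j k => (sp (c j k)).1 p)
    (-(of fun j k => (sp (a j k)).1 p)ᵀ)
  have hM : T.HasBlocks M := by
    refine ⟨fun p => (mem_so2n_iff _).2 ⟨_, _, _, ?_, ?_, rfl⟩, fun j k => (sp (a j k)).2,
      fun j k => (sm (b j k)).2, fun j k => (sp (c j k)).2⟩
    · ext j k
      simp only [transpose_apply, of_apply, hb j k, map_neg, Matrix.neg_apply]
      rfl
    · ext j k
      simp only [transpose_apply, of_apply, hc j k, map_neg, Matrix.neg_apply]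
      rfl
  have hr : T.HasTyurinResidues M 0 ν m := by
    refine ⟨fun i => ?_, fun i => ?_⟩
    · rw [hasRes_iff, tyurinResidue_elim]
      rintro (j | j) (k | k)
      · refine cast ?_ (hsp (a j k) i)
        congr 1
        simp [a, vecMulVec_apply]
      · refine cast ?_ (hasScalarRes_zero (sm (b j k)).2 (hT.divMinus_q i))
        congr 1
        simp
      · exact hsp (c j k) i
      · refine cast ?_ (hsp (a k j) i).neg
        congr 1
        simp [a, vecMulVec_apply, mul_comm]
    · rw [hasRes_iff, tyurinResidue_elim]
      rintro (j | j) (k | k)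
      · refine cast ?_ (hasScalarRes_zero (sp (a j k)).2 (hT.divPlus_neg_q i))
        congr 1
        simp
      · exact hsm (b j k) i
      · refine cast ?_ (hasScalarRes_zero (sp (c j k)).2 (hT.divPlus_neg_q i))
        congr 1
        simp
      · refine cast ?_ (hasScalarRes_zero (sp (a k j)).2 (hT.divPlus_neg_q i)).neg
        congr 1
        simp
  exact ⟨⟨M, hM, _, _, _, hr⟩, residues_eq hr⟩

theorem range_residues (hD : T.D ≠ 0) (hT : T.Generic) :
    T.residues.range = T.paramResidues.range := by
  refine le_antisymm ?_ ?_
  · rintro _ ⟨M, rfl⟩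
    exact residues_mem_range hT M
  · rintro _ ⟨x, rfl⟩
    exact exists_residues_eq hD hT x

variable (T) in
/-- The `so(2n)`-valued function with the given coordinates. -/
def ofCoords : (Fin (Module.finrank ℂ (so2n n)) → rrSpace L T.marked T.intD) →ₗ[ℂ]
    (Curve L → Mat n) where
  toFun f := fun p => ∑ i, (f i).1 p • (Module.finBasis ℂ (so2n n) i).1
  map_add' f g := by
    ext1 p
    simp [add_smul, Finset.sum_add_distrib]
  map_smul' c f := by
    ext1 p
    simp [mul_smul, Finset.smul_sum]

theorem ofCoords_injective : Function.Injective T.ofCoords := by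
  rw [← LinearMap.ker_eq_bot, LinearMap.ker_eq_bot']
  intro f hf
  ext i p
  have h1 : ∑ i, (f i).1 p • Module.finBasis ℂ (so2n n) i = 0 := by
    ext1
    rw [Submodule.coe_sum]
    exact congr_fun hf p
  exact Fintype.linearIndependent_iff.1 (Module.finBasis ℂ (so2n n)).linearIndependent
    (fun i => (f i).1 p) h1 i

theorem ofCoords_entry_mem (f : Fin (Module.finrank ℂ (so2n n)) → rrSpace L T.marked T.intD)
    (j k : Fin n ⊕ Fin n) : (fun p => T.ofCoords f p j k) ∈ rrSpace L T.marked T.intD := by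
  have e : (fun p => T.ofCoords f p j k) =
      ∑ i, (Module.finBasis ℂ (so2n n) i).1 j k • (f i).1 := by
    ext p
    simp only [ofCoords, LinearMap.coe_mk, AddHom.coe_mk, Matrix.sum_apply, Matrix.smul_apply,
      Finset.sum_apply, Pi.smul_apply, smul_eq_mul, mul_comm]
  rw [e]
  exact Submodule.sum_mem _ fun i _ => Submodule.smul_mem _ _ (f i).2

theorem intD_le_divPlus : T.intD ≤ T.divPlus :=
  le_add_of_nonneg_right (Finset.sum_nonneg fun _ _ => Finsupp.single_nonneg.2 zero_le_one)

theorem intD_le_divMinus : T.intD ≤ T.divMinus :=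
  le_add_of_nonneg_right (Finset.sum_nonneg fun _ _ => Finsupp.single_nonneg.2 zero_le_one)

/-- The coordinate forms of `so(2n)` extend to all matrices, so the coordinates of `M` are constant
linear combinations of its entries and stay in the Riemann-Roch space. -/
theorem mem_range_ofCoords {M : Curve L → Mat n} (hso : ∀ p, M p ∈ so2n n)
    (h : ∀ j k, (fun p => M p j k) ∈ rrSpace L T.marked T.intD) : M ∈ T.ofCoords.range := by
  have hext : ∀ i, ∃ l : Mat n →ₗ[ℂ] ℂ,
      l ∘ₗ (so2n n).subtype = (Module.finBasis ℂ (so2n n)).coord i := fun i =>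
    LinearMap.exists_extend _
  choose l hl using hext
  refine ⟨fun i => ⟨fun p => l i (M p), linearForm_mem_rrSpace (l i) h⟩, funext fun p => ?_⟩
  have hco : ∀ i, l i (M p) = (Module.finBasis ℂ (so2n n)).repr ⟨M p, hso p⟩ i := fun i =>
    LinearMap.congr_fun (hl i) ⟨M p, hso p⟩
  have := congr_arg Subtype.val ((Module.finBasis ℂ (so2n n)).sum_repr ⟨M p, hso p⟩)
  rw [Submodule.coe_sum] at this
  change ∑ i, l i (M p) • (Module.finBasis ℂ (so2n n) i).1 = M p
  simp only [hco]
  exact this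

/-- A simple pole with zero residue is removable, so only the poles bounded by `D` survive;
conversely such functions have zero residues at `±qᵢ`, which lie off the support of `D`. -/
theorem map_ker_residues (hT : T.Generic) :
    T.residues.ker.map T.ND.subtype = T.ofCoords.range := by
  ext M
  constructor
  · rintro ⟨⟨M, hM⟩, hker, rfl⟩
    obtain ⟨hb, μ', μ'', μm, hr⟩ := hM
    have hk := (residues_eq (M := ⟨M, hb, μ', μ'', μm, hr⟩) hr).symm.trans hker
    obtain ⟨hk1, hk2⟩ := Prod.ext_iff.1 hk
    have h1 : ∀ i, HasRes M (T.q i) 0 := fun i => by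
      have e := congr_fun hk1 i
      exact cast (congr_arg _ e) (hr.res_q i)
    have h2 : ∀ i, HasRes M (-T.q i) 0 := fun i => by
      have e := congr_fun hk2 i
      exact cast (congr_arg _ e) (hr.res_neg_q i)
    have hA : ∀ j k : Fin n, (fun p => M p (.inl j) (.inl k)) ∈ rrSpace L T.marked T.intD :=
      fun j k => mem_rrSpace_of_hasScalarRes_zero hT.q_injective hT.intD_q (hb.blockA j k)
        fun i => hasRes_iff.1 (h1 i) _ _
    refine mem_range_ofCoords hb.mem_so ?_
    rintro (j | j) (k | k)
    · exact hA j k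
    · exact mem_rrSpace_of_hasScalarRes_zero hT.neg_q_injective hT.intD_neg_q (hb.blockB j k)
        fun i => hasRes_iff.1 (h2 i) _ _
    · exact mem_rrSpace_of_hasScalarRes_zero hT.q_injective hT.intD_q (hb.blockC j k)
        fun i => hasRes_iff.1 (h1 i) _ _
    · have := neg_mem (hA k j)
      exact (funext fun p => hb.apply_inr_inr p j k) ▸ this
  · rintro ⟨f, rfl⟩
    have hmem := ofCoords_entry_mem f
    have hb : T.HasBlocks (T.ofCoords f) :=
      ⟨fun p => (so2n n).sum_mem (t := Finset.univ) fun i _ =>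
        (so2n n).smul_mem ((f i).1 p) (Module.finBasis ℂ (so2n n) i).2,
        fun j k => rrSpace_mono intD_le_divPlus (hmem _ _),
        fun j k => rrSpace_mono intD_le_divMinus (hmem _ _),
        fun j k => rrSpace_mono intD_le_divPlus (hmem _ _)⟩
    have hr : T.HasTyurinResidues (T.ofCoords f) 0 0 0 := by
      refine ⟨fun i => ?_, fun i => ?_⟩
      · rw [Pi.zero_apply, Sum.elim_zero_zero, tyurinResidue_zero, hasRes_iff]
        exact fun j k => hasScalarRes_zero (hmem j k) (hT.intD_q i)
      · rw [Pi.zero_apply, Sum.elim_zero_zero, tyurinResidue_zero, hasRes_iff]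
        exact fun j k => hasScalarRes_zero (hmem j k) (hT.intD_neg_q i)
    refine ⟨⟨_, hb, 0, 0, 0, hr⟩, ?_, rfl⟩
    rw [SetLike.mem_coe, LinearMap.mem_ker, residues_eq hr]
    simp only [Pi.zero_apply, Sum.elim_zero_zero, tyurinResidue_zero]
    rfl

/-- Rank-nullity: the kernel contributes `dim 𝔤 · deg D`, and the image contributes `2n² - n = dim
𝔤`. -/
theorem finrank_ND (hD : T.D ≠ 0) (hT : T.Generic) :
    FiniteDimensional ℂ T.ND ∧
      Module.finrank ℂ T.ND = Module.finrank ℂ (so2n n) * (T.deg + 1) := by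
  obtain ⟨hfd, hdim⟩ := finrank_rrSpace_intD hD
  let e : T.residues.ker ≃ₗ[ℂ] T.ofCoords.range :=
    (T.residues.ker.equivMapOfInjective T.ND.subtype T.ND.injective_subtype).trans
      (LinearEquiv.ofEq _ _ (map_ker_residues hT))
  have hker : FiniteDimensional ℂ T.residues.ker := Module.Finite.equiv e.symm
  have hND := finite_of_finite_ker _ hker
  refine ⟨hND, ?_⟩
  have h1 := finrank_range_paramResidues hT
  have h2 := finrank_so2n_add n
  rw [← LinearMap.finrank_range_add_finrank_ker T.residues, range_residues hD hT, e.finrank_eq,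
    LinearMap.finrank_range_of_inj ofCoords_injective, Module.finrank_pi_fintype]
  simp only [hdim, Finset.sum_const, Finset.card_univ, Fintype.card_fin, smul_eq_mul]
  rw [mul_add, mul_one]
  omega

/-- The motions of `qᵢ` and `-qᵢ` can be matched by adding multiples of `α₋ᵢ` to `μ₋ᵢ`, which does
not change the residues. -/
theorem NDlinked_eq_ND (h : ∀ i, T.am i ⬝ᵥ T.am i ≠ 0) : T.NDlinked = T.ND := by
  refine le_antisymm ?_ ?_
  · rintro M ⟨hb, μ', μ'', μm, hr, -⟩
    exact ⟨hb, μ', μ'', μm, hr⟩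
  · rintro M ⟨hb, μ', μ'', μm, hr⟩
    -- Adding `cᵢ α₋ᵢ'` lowers the velocity of `-qᵢ` by `cᵢ α₋ᵢ'ᵗ α₋ᵢ'`; this `cᵢ` makes that equal
    -- to the defect in the linking condition.
    let c : Fin n → ℂ := fun i => (T.velPlus μ' μ'' i + T.velMinus μm i) / (T.am i ⬝ᵥ T.am i)
    refine ⟨hb, μ', μ'', fun i => μm i + c i • T.am i, ⟨hr.res_q, fun i => ?_⟩, fun i => ?_⟩
    · have e : (Sum.elim (μm i + c i • T.am i) 0 : Fin n ⊕ Fin n → ℂ) =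
          Sum.elim (μm i) 0 + c i • Sum.elim (T.am i) 0 := by
        rw [← elim_smul, ← elim_add, smul_zero, add_zero]
      rw [e, tyurinResidue_add_smul_self]
      exact hr.res_neg_q i
    · have hc : c i * (T.am i ⬝ᵥ T.am i) = T.velPlus μ' μ'' i + T.velMinus μm i :=
        div_mul_cancel₀ _ (h i)
      have e : T.velMinus (fun i => μm i + c i • T.am i) i =
          T.velMinus μm i - c i * (T.am i ⬝ᵥ T.am i) := by
        simp only [velMinus, add_dotProduct, smul_dotProduct, smul_eq_mul]
        ring
      rw [e, hc]
      ring

end Data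

end Dimension

end EllipticDn

end

theorem mainTheorem10 (L : PeriodPair) (n : ℕ) (T : EllipticDn.Data L n)
    (hD : T.D ≠ 0) (hT : T.Generic) :
    (FiniteDimensional ℂ T.ND ∧
      Module.finrank ℂ T.ND = Module.finrank ℂ (EllipticDn.so2n n) * (T.deg + 1)) ∧
    ((∀ i, T.am i ⬝ᵥ T.am i ≠ 0) →
      FiniteDimensional ℂ T.NDlinked ∧
      Module.finrank ℂ T.NDlinked = Module.finrank ℂ (EllipticDn.so2n n) * (T.deg + 1)) := by
  refine ⟨EllipticDn.Data.finrank_ND hD hT, fun h => ?_⟩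
  rw [EllipticDn.Data.NDlinked_eq_ND h]
  exact EllipticDn.Data.finrank_ND hD hT
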